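/- All graphs are finite and simple. For a graph $G$ on $n$ vertices, $M(G)$ (the maximum nullity) is the largest nullity of a real symmetric $n\times n$ matrix $A=(a_{ij})$, indexed by $V(G)$, such that for $i\neq j$ one has $a_{ij}\neq 0$ exactly when $i$ and $j$ are adjacent (the diagonal is arbitrary). $Z(G)$ (the zero forcing number) is the least size of a set $Z\subseteq V(G)$ such that, if the vertices of $Z$ are colored black and all others white, then repeated use of the rule "a black vertex with exactly one white neighbor $v$ turns $v$ black" makes all vertices black. For $n\ge 0$ let $L_n$ be the ladder with $n$ squares: two paths $a_0a_1\cdots a_n$ and $b_0b_1\cdots b_n$ and the $n+1$ rungs $a_ib_i$. Let $M_n$ be $L_n$ with two further vertices $c,d$ and the edges $b_nc$, $cd$; its vertices $a_0,b_0$ are marked yellow and its vertices $a_n,c,d$ are marked white (so $M_0\cong P_4$, with $a_0$ carrying both marks). Let $T_n$ be $L_n$ with one further vertex $o$ and the edges $a_no$, $b_no$; its vertices $a_0,b_0,o$ are marked yellow and none is marked white (so $T_0\cong K_3$). For a marked graph $H$, let $K_1\blacktriangle H$ be obtained from $H$ by adding a new vertex adjacent to all vertices of $H$ that are yellow or have degree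 $1$ in $H$; its white vertices are those of $H$. For marked graphs $H$ and $K$, the family $H\uplus K$ consists of all graphs obtained from the disjoint union of $H$ and $K$ by adding the edges $uf(u)$, where $f$ is any bijection from the set of white vertices of $H$ onto the set of vertices of $K$ that are yellow or have degree $1$ in $K$; its white vertices are those of $K$. Operations are performed from left to right, and $\mathcal F\uplus K$ for a family $\mathcal F$ is the union of the families $H\uplus K$, $H\in\mathcal F$. **Corollary.** Let $G$ be a cubic graph. Then $Z(G)=M(G)=3$ if and only if $G$ is isomorphic to one of the following graphs: (i) $K_1\blacktriangle T_m$ for some $m\ge 0$; (ii) a member of the family $K_1\blacktriangle M_{n_1}\uplus\cdots\uplus M_{n_t}\uplus T_m$ for some $t\ge 1$ and some $n_1,\dots,n_t,m\ge 0$. -/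

import Mathlib

namespace CubicZF

/-! ### Zero forcing -/

/-- One application of the color-change rule to the set `B` of black vertices: some black vertex `u`
has exactly one white neighbor `v`, and `v` becomes black. -/
def ColorChange {V : Type*} (G : SimpleGraph V) (B B' : Set V) : Prop :=
  ∃ u ∈ B, ∃ v, G.neighborSet u \ B = {v} ∧ B' = insert v B

/-- `Z` is a zero forcing set: starting from exactly the vertices of `Z` black, repeated application
of the color-change rule makes all vertices black. -/
def IsZeroForcingSet {V : Type*} (G : SimpleGraph V) (Z : Set V) : Prop :=
  Relation.ReflTransGen (ColorChange G) Z Set.univ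

/-- The zero forcing number `Z(G)` (the set below contains the order of `G`, as the set of all
vertices is zero forcing, so the infimum is a minimum). -/
noncomputable def zeroForcingNumber {V : Type*} [Fintype V] (G : SimpleGraph V) : ℕ :=
  sInf {k | ∃ Z : Finset V, IsZeroForcingSet G (Z : Set V) ∧ Z.card = k}

/-! ### Maximum nullity -/

/-- `S(G)`: the real symmetric matrices whose off-diagonal entries are nonzero exactly at the pairs
of adjacent vertices; the diagonal is free. -/
def symmMatrices {V : Type*} (G : SimpleGraph V) : Set (Matrix V V ℝ) :=
  {A | A.IsSymm ∧ ∀ i j, i ≠ j → (A i j ≠ 0 ↔ G.Adj i j)}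

/-- The nullity of a real square matrix. -/
noncomputable def nullity {V : Type*} [Fintype V] (A : Matrix V V ℝ) : ℕ :=
  Module.finrank ℝ (LinearMap.ker A.mulVecLin)

/-- The maximum nullity `M(G)`; see `nullity_le` and `symmMatrices_nonempty`: the set is nonempty
and bounded, so the supremum is a maximum. -/
noncomputable def maxNullity {V : Type*} [Fintype V] (G : SimpleGraph V) : ℕ :=
  sSup (nullity '' symmMatrices G)

theorem nullity_le {V : Type*} [Fintype V] (A : Matrix V V ℝ) : nullity A ≤ Fintype.card V := by
  have h := Submodule.finrank_le (LinearMap.ker A.mulVecLin)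
  rwa [Module.finrank_fintype_fun_eq_card] at h

theorem symmMatrices_nonempty {V : Type*} (G : SimpleGraph V) : (symmMatrices G).Nonempty := by
  classical
  refine ⟨G.adjMatrix ℝ, G.isSymm_adjMatrix, fun i j _ => ?_⟩
  simp [SimpleGraph.adjMatrix_apply]

/-! ### Graphs with white and yellow vertices, and the two operations on them -/

/-- A graph some of whose vertices are colored white and some yellow (a vertex may carry both
colors, one color, or none). -/
structure ColoredGraph where
  V : Type
  graph : SimpleGraph V
  white : Set V
  yellow : Set V

/-- The vertices that are yellow or pendant (of degree one). -/
def ColoredGraph.ports (H : ColoredGraph) : Set H.V :=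
  {v | v ∈ H.yellow ∨ (H.graph.neighborSet v).ncard = 1}

/-- The graph `G` with a new vertex `none` joined to all vertices of `P`. -/
def coneGraph {V : Type} (G : SimpleGraph V) (P : Set V) : SimpleGraph (Option V) :=
  SimpleGraph.fromRel fun x y =>
    match x, y with
    | some a, some b => G.Adj a b
    | none, some b => b ∈ P
    | _, none => False

/-- `K₁ ▲ H`: a new vertex is joined to all yellow and all pendant vertices of `H`. The yellow color
has then been used up; the white vertices are those of `H`. -/
abbrev cone (H : ColoredGraph) : ColoredGraph where
  V := Option H.V
  graph := coneGraph H.graph H.ports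
  white := some '' H.white
  yellow := ∅

/-- The disjoint union of `G` and `G'` together with the edges `u f(u)` for `u` in `A`. -/
def compoundGraph {V V' : Type} (G : SimpleGraph V) (G' : SimpleGraph V') {A : Set V} {B : Set V'}
    (f : A ≃ B) : SimpleGraph (V ⊕ V') :=
  SimpleGraph.fromRel fun x y =>
    match x, y with
    | Sum.inl a, Sum.inl b => G.Adj a b
    | Sum.inr a, Sum.inr b => G'.Adj a b
    | Sum.inl a, Sum.inr b => ∃ ha : a ∈ A, (f ⟨a, ha⟩ : V') = b
    | Sum.inr _, Sum.inl _ => False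

/-- A member of the compound `H ⊎ K`: the disjoint union of `H` and `K` together with the edges
`u f(u)`, where `f` is a bijection from the white vertices of `H` onto the yellow or pendant vertices
of `K`. The white vertices of `H` and the yellow vertices of `K` have then been used up. -/
abbrev compound (H K : ColoredGraph) (f : H.white ≃ K.ports) : ColoredGraph where
  V := H.V ⊕ K.V
  graph := compoundGraph H.graph K.graph f
  white := Sum.inr '' K.white
  yellow := Sum.inl '' H.yellow

/-! ### The building blocks -/

/-- The ladder with `n` squares: two paths with vertices `(0, s), …, (n, s)`, for `s` one of the two
sides `true` (top) and `false` (bottom), and the `n + 1` rungs `(i, true) (i, false)`. -/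
def ladder (n : ℕ) : SimpleGraph (Fin (n + 1) × Bool) :=
  SimpleGraph.fromRel fun x y =>
    (x.1 = y.1 ∧ x.2 ≠ y.2) ∨ ((x.1 : ℕ) + 1 = (y.1 : ℕ) ∧ x.2 = y.2)

/-- The ladder with `n` squares and a tail `c = inr false`, `d = inr true`, with edges from the last
bottom vertex of the ladder to `c` and from `c` to `d`. -/
def graphM (n : ℕ) : SimpleGraph ((Fin (n + 1) × Bool) ⊕ Bool) :=
  SimpleGraph.fromRel fun x y =>
    match x, y with
    | Sum.inl a, Sum.inl b => (ladder n).Adj a b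
    | Sum.inl a, Sum.inr t => a = (Fin.last n, false) ∧ t = false
    | Sum.inr s, Sum.inr t => s = false ∧ t = true
    | Sum.inr _, Sum.inl _ => False

/-- `Mₙ`: in `graphM n`, the first two vertices of the ladder are yellow; the last top vertex of the
ladder and the tail vertices `c` and `d` are white. In particular `M₀` is a path on four vertices. -/
abbrev M (n : ℕ) : ColoredGraph where
  V := (Fin (n + 1) × Bool) ⊕ Bool
  graph := graphM n
  white := {Sum.inl (Fin.last n, true), Sum.inr false, Sum.inr true}
  yellow := {Sum.inl (0, true), Sum.inl (0, false)}

/-- The ladder with `n` squares and one more vertex `inr ()`, adjacent to the last top and the last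
bottom vertex of the ladder. -/
def graphT (n : ℕ) : SimpleGraph ((Fin (n + 1) × Bool) ⊕ Unit) :=
  SimpleGraph.fromRel fun x y =>
    match x, y with
    | Sum.inl a, Sum.inl b => (ladder n).Adj a b
    | Sum.inl a, Sum.inr _ => a.1 = Fin.last n
    | Sum.inr _, _ => False

/-- `Tₙ`: in `graphT n`, the first two vertices of the ladder and the additional vertex are yellow,
and no vertex is white. In particular `T₀` is a triangle. -/
abbrev T (n : ℕ) : ColoredGraph where
  V := (Fin (n + 1) × Bool) ⊕ Unit
  graph := graphT n
  white := ∅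
  yellow := {Sum.inl (0, true), Sum.inl (0, false), Sum.inr ()}

/-- `H` is a member of the family `K₁ ▲ G₁ ⊎ ⋯ ⊎ G_t` (operations from left to right), for some
`t ≥ 1`, where each `Gᵢ` is some `Mₙ`, with `n ≥ 0` depending on `i`. -/
inductive IsMChain : ColoredGraph → Prop
  | base (n : ℕ) : IsMChain (cone (M n))
  | step {H : ColoredGraph} (hH : IsMChain H) (n : ℕ) (f : H.white ≃ (M n).ports) :
      IsMChain (compound H (M n) f)

/-- `G` is isomorphic to `K₁ ▲ T_m` for some `m ≥ 0`, or to a member of the family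
`K₁ ▲ G₁ ⊎ ⋯ ⊎ G_t ⊎ T_m`, where `t ≥ 1`, `m ≥ 0` and each `Gᵢ` is some `Mₙ`. -/
def InFamily {V : Type*} (G : SimpleGraph V) : Prop :=
  (∃ m : ℕ, Nonempty (G ≃g (cone (T m)).graph)) ∨
  (∃ H : ColoredGraph, IsMChain H ∧ ∃ (m : ℕ) (f : H.white ≃ (T m).ports),
    Nonempty (G ≃g (compound H (T m) f).graph))

end CubicZF

/-! A set is zero forcing when every proper superset still admits a force (`Progresses`); this
removes all bookkeeping about the order of the forces. In a cubic graph a set containing such an `S`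
with at most two boundary vertices is already everything (`Progresses.eq_univ_of_boundary`). Hence Z
≥ 3, and the same lemma excludes almost every configuration in the structure argument.

Z = 3 implies M = 3. The bound M ≤ Z holds because a kernel vector vanishing on a zero forcing set
is zero. Conversely, a matrix is built along the forces. At most three vertices are on the boundary
at any time, and eliminating all the others leaves a symmetric 3 × 3 matrix on the current triple.
The free diagonal keeps its diagonal zero, and the weights of new edges keep the off-diagonal
entries nonzero until the last vertex, where all three are made to vanish. The values on the triple
are then arbitrary, so the nullity is at least 3 (`HasReduction.force`, `three_le_maxNullity`).

Z = 3 holds exactly on the family. A member is forced block by block from the apex and the first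
rung (`InFamily.exists_forcing_triple`). Conversely, the first forcing vertex `u` gives a front: a
set `D = {u}` with three outside neighbors. Among these there are either three edges, and the graph
ends, or exactly one, and the front advances past that edge (`Front.adj_cases`, `Front.advance`).
Repeated advances on the same side add rungs to a ladder. An edge between the ladder side and the
waiting third vertex closes a block `M n`, and a triangle closes a block `T m` (`Front.inFamily`).
-/

namespace CubicZF

/-! ### Zero forcing in cubic graphs and the bound M ≤ Z. -/

section Forcing

variable {V : Type*} {G : SimpleGraph V}

/-- Every proper superset of `S` contains a vertex that can force: the order-free form of
"`S` is a zero forcing set". -/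
def Progresses (G : SimpleGraph V) (S : Set V) : Prop :=
  ∀ B, S ⊆ B → B ≠ Set.univ →
    ∃ u ∈ B, ∃ v, v ∉ B ∧ G.Adj u v ∧ ∀ w, G.Adj u w → w ∈ B ∨ w = v

/-- A force at some `C ⊆ B` onto a vertex outside `B` is still a force at `B`. So if `B` admits
none, forcing from `S` never leaves `B`. -/
theorem IsZeroForcingSet.progresses {S : Set V} (h : IsZeroForcingSet G S) : Progresses G S := by
  intro B hSB hB
  by_contra hcon
  push Not at hcon
  apply hB
  have key : ∀ C, Relation.ReflTransGen (ColorChange G) S C → C ⊆ B := by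
    intro C hC
    induction hC with
    | refl => exact hSB
    | tail _ hstep ih =>
      obtain ⟨u, hu, v, hv, rfl⟩ := hstep
      refine Set.insert_subset ?_ ih
      by_contra hvB
      have huv : v ∈ G.neighborSet u \ _ := hv ▸ Set.mem_singleton v
      obtain ⟨w, hw, hwB, hne⟩ := hcon u (ih hu) v hvB huv.1
      have : w ∈ G.neighborSet u \ _ := ⟨hw, fun hwC => hwB (ih hwC)⟩
      rw [hv] at this
      exact hne this
  exact Set.eq_univ_of_univ_subset (key _ h)

/-- Induction on the complement of a subset of a finite type. -/
theorem set_induction_compl [Finite V] {p : Set V → Prop}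
    (h : ∀ B, (∀ B', B ⊂ B' → p B') → p B) (B : Set V) : p B := by
  induction hn : Bᶜ.ncard using Nat.strong_induction_on generalizing B with
  | _ n ih =>
    refine h B fun B' hB' => ih _ ?_ B' rfl
    rw [← hn]
    exact Set.ncard_lt_ncard (compl_lt_compl_iff_lt.2 hB') (Set.toFinite _)

theorem Progresses.isZeroForcingSet [Finite V] {S : Set V} (h : Progresses G S) :
    IsZeroForcingSet G S := by
  have key : ∀ B, S ⊆ B → Relation.ReflTransGen (ColorChange G) B Set.univ := by
    intro B
    induction B using set_induction_compl with
    | _ B ih =>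
    intro hSB
    by_cases hB : B = Set.univ
    · rw [hB]
    obtain ⟨u, hu, v, hv, huv, hw⟩ := h B hSB hB
    refine Relation.ReflTransGen.head ⟨u, hu, v, ?_, rfl⟩
      (ih _ (Set.ssubset_insert hv) (hSB.trans (Set.subset_insert _ _)))
    ext w
    simp only [Set.mem_sdiff, SimpleGraph.mem_neighborSet, Set.mem_singleton_iff]
    constructor
    · rintro ⟨h1, h2⟩
      exact (hw w h1).resolve_left h2
    · rintro rfl
      exact ⟨huv, hv⟩
  exact key S subset_rfl

/-- Every vertex has exactly three neighbors. -/
def IsCubic (G : SimpleGraph V) : Prop :=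
  ∀ v, ∃ a b c, a ≠ b ∧ a ≠ c ∧ b ≠ c ∧ ∀ w, G.Adj v w ↔ w = a ∨ w = b ∨ w = c

theorem isCubic_of_isRegularOfDegree [G.LocallyFinite] (h : G.IsRegularOfDegree 3) :
    IsCubic G := by
  classical
  intro v
  obtain ⟨a, b, c, hab, hac, hbc, hs⟩ := Finset.card_eq_three.1 (h v)
  refine ⟨a, b, c, hab, hac, hbc, fun w => ?_⟩
  rw [← SimpleGraph.mem_neighborFinset, hs]
  simp

theorem IsCubic.exists_ne (h : IsCubic G) (v x y : V) : ∃ w, G.Adj v w ∧ w ≠ x ∧ w ≠ y := by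
  obtain ⟨a, b, c, hab, hac, hbc, hw⟩ := h v
  by_contra! hcon
  have h1 := hcon a ((hw a).2 (by simp))
  have h2 := hcon b ((hw b).2 (by simp))
  have h3 := hcon c ((hw c).2 (by simp))
  by_cases hax : a = x <;> by_cases hbx : b = x <;> grind

theorem IsCubic.exists_third (h : IsCubic G) {v x y : V} (hx : G.Adj v x) (hy : G.Adj v y)
    (hxy : x ≠ y) :
    ∃ z, G.Adj v z ∧ z ≠ x ∧ z ≠ y ∧ ∀ w, G.Adj v w → w = x ∨ w = y ∨ w = z := by
  obtain ⟨a, b, c, hab, hac, hbc, hw⟩ := h v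
  rw [hw] at hx hy
  have key : ∃ z, (z = a ∨ z = b ∨ z = c) ∧ z ≠ x ∧ z ≠ y ∧
      ∀ w, w = a ∨ w = b ∨ w = c → w = x ∨ w = y ∨ w = z := by
    rcases hx with rfl | rfl | rfl <;> rcases hy with rfl | rfl | rfl
    · exact absurd rfl hxy
    · exact ⟨c, by grind⟩
    · exact ⟨b, by grind⟩
    · exact ⟨c, by grind⟩
    · exact absurd rfl hxy
    · exact ⟨a, by grind⟩
    · exact ⟨b, by grind⟩
    · exact ⟨a, by grind⟩
    · exact absurd rfl hxy
  simpa only [hw] using key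

theorem IsCubic.exists_second_third (h : IsCubic G) {v x : V} (hx : G.Adj v x) :
    ∃ y z, y ≠ x ∧ z ≠ x ∧ y ≠ z ∧ ∀ w, G.Adj v w ↔ w = x ∨ w = y ∨ w = z := by
  obtain ⟨a, b, c, hab, hac, hbc, hw⟩ := h v
  simp only [hw] at *
  rcases hx with rfl | rfl | rfl
  · exact ⟨b, c, hab.symm, hac.symm, hbc, fun w => Iff.rfl⟩
  · exact ⟨a, c, hab, hbc.symm, hac, fun w => by tauto⟩
  · exact ⟨a, b, hac, hbc, hab, fun w => by tauto⟩

theorem IsCubic.eq_of_adj (h : IsCubic G) {v x y z : V} (hx : G.Adj v x) (hy : G.Adj v y)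
    (hz : G.Adj v z) (hxy : x ≠ y) (hxz : x ≠ z) (hyz : y ≠ z) {w : V} (hw : G.Adj v w) :
    w = x ∨ w = y ∨ w = z := by
  obtain ⟨a, b, c, hab, hac, hbc, hw'⟩ := h v
  simp only [hw'] at *
  grind

/-- A set from which at most two vertices have neighbors outside cannot progress. -/
theorem Progresses.eq_univ_of_boundary [Finite V] {S : Set V} (h : Progresses G S)
    (hG : IsCubic G) (B : Set V) : S ⊆ B → ∀ x y, (∀ u ∈ B, ∀ w, w ∉ B → G.Adj u w → u = x ∨ u = y) →
      B = Set.univ := by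
  induction B using set_induction_compl with
  | _ B ih =>
  intro hSB x y hxy
  by_contra hB
  obtain ⟨u, hu, v, hv, huv, hw⟩ := h B hSB hB
  have huniv : insert v B = Set.univ := by
    rcases hxy u hu v hv huv with rfl | rfl
    · refine ih _ (Set.ssubset_insert hv) (hSB.trans (Set.subset_insert _ _)) v y ?_
      intro a ha w hwB haw
      simp only [Set.mem_insert_iff, not_or] at ha hwB
      grind
    · refine ih _ (Set.ssubset_insert hv) (hSB.trans (Set.subset_insert _ _)) v x ?_
      intro a ha w hwB haw
      simp only [Set.mem_insert_iff, not_or] at ha hwB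
      grind
  -- Now `v` is the only vertex outside `B`, so its neighbor other than `x` and `y` is a third
  -- boundary vertex of `B`.
  obtain ⟨w, hvw, hwx, hwy⟩ := hG.exists_ne v x y
  have hwB : w ∈ B := by
    have : w ∈ insert v B := huniv ▸ Set.mem_univ w
    exact this.resolve_left hvw.ne'
  rcases hxy w hwB v hv hvw.symm with rfl | rfl <;> contradiction

theorem Progresses.three_le_card [Finite V] [Nonempty V] (hG : IsCubic G) {S : Finset V}
    (h : Progresses G (S : Set V)) : 3 ≤ S.card := by
  classical
  by_contra! hlt
  have hxy : ∃ x y, ∀ u ∈ S, u = x ∨ u = y := by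
    have : S.card = 0 ∨ S.card = 1 ∨ S.card = 2 := by omega
    obtain ⟨v⟩ := ‹Nonempty V›
    rcases this with h | h | h
    · exact ⟨v, v, by simp [Finset.card_eq_zero.1 h]⟩
    · obtain ⟨x, rfl⟩ := Finset.card_eq_one.1 h
      exact ⟨x, x, by simp⟩
    · obtain ⟨x, y, -, rfl⟩ := Finset.card_eq_two.1 h
      exact ⟨x, y, by simp⟩
  obtain ⟨x, y, hxy⟩ := hxy
  have huniv := h.eq_univ_of_boundary hG (S : Set V) subset_rfl x y (fun u hu _ _ _ => hxy u hu)
  obtain ⟨v⟩ := ‹Nonempty V›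
  obtain ⟨w, -, hwx, hwy⟩ := hG.exists_ne v x y
  have hw : w ∈ (S : Set V) := huniv ▸ Set.mem_univ w
  rcases hxy w hw with rfl | rfl <;> contradiction

theorem exists_progresses_card_eq [Fintype V] (G : SimpleGraph V) :
    ∃ S : Finset V, Progresses G (S : Set V) ∧ S.card = zeroForcingNumber G := by
  have hne : {k | ∃ Z : Finset V, IsZeroForcingSet G (Z : Set V) ∧ Z.card = k}.Nonempty :=
    ⟨_, Finset.univ, by rw [Finset.coe_univ]; exact Relation.ReflTransGen.refl, rfl⟩
  obtain ⟨S, hS, hc⟩ := Nat.sInf_mem hne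
  exact ⟨S, hS.progresses, hc⟩

theorem zeroForcingNumber_le [Fintype V] {S : Finset V} (h : Progresses G (S : Set V)) :
    zeroForcingNumber G ≤ S.card :=
  Nat.sInf_le ⟨S, h.isZeroForcingSet, rfl⟩

theorem three_le_zeroForcingNumber [Fintype V] [Nonempty V] (hG : IsCubic G) :
    3 ≤ zeroForcingNumber G := by
  obtain ⟨S, hS, hc⟩ := exists_progresses_card_eq G
  rw [← hc]
  exact hS.three_le_card hG

/-- If the zero set of `x` were proper, some `u` in it would have a single neighbor `v` outside it,
and row `u` of `A x = 0` would reduce to `A u v * x v = 0`. -/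
theorem Progresses.eq_zero_of_mulVec [Fintype V] {S : Set V} (h : Progresses G S)
    {A : Matrix V V ℝ} (hA : A ∈ symmMatrices G) {x : V → ℝ} (hx : A.mulVec x = 0)
    (hS : ∀ v ∈ S, x v = 0) : x = 0 := by
  classical
  by_contra hne
  have hB : {v | x v = 0} ≠ Set.univ := fun hu =>
    hne (funext fun v => (hu ▸ Set.mem_univ v : v ∈ {v | x v = 0}))
  obtain ⟨u, hu, v, hv, huv, hw⟩ := h _ hS hB
  have hrow := congrFun hx u
  rw [Matrix.mulVec, dotProduct, Finset.sum_eq_single v] at hrow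
  · rcases mul_eq_zero.1 hrow with h0 | h0
    · exact ((hA.2 u v huv.ne).2 huv) h0
    · exact hv h0
  · intro w _ hwv
    by_cases hadj : G.Adj u w
    · have : x w = 0 := (hw w hadj).resolve_right hwv
      rw [this, mul_zero]
    · by_cases huw : u = w
      · subst huw
        have : x u = 0 := hu
        rw [this, mul_zero]
      · have : A u w = 0 := by
          by_contra h0
          exact hadj ((hA.2 u w huw).1 h0)
        rw [this, zero_mul]
  · simp

theorem nullity_le_card [Fintype V] {S : Finset V} (h : Progresses G (S : Set V))
    {A : Matrix V V ℝ} (hA : A ∈ symmMatrices G) : nullity A ≤ S.card := by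
  let f : LinearMap.ker A.mulVecLin →ₗ[ℝ] (S → ℝ) :=
    (LinearMap.funLeft ℝ ℝ (Subtype.val : S → V)).comp (Submodule.subtype _)
  have hf : Function.Injective f := by
    rw [← LinearMap.ker_eq_bot, LinearMap.ker_eq_bot']
    rintro ⟨x, hx⟩ hfx
    refine Subtype.ext (h.eq_zero_of_mulVec hA (by simpa using hx) fun v hv => ?_)
    exact congrFun hfx ⟨v, hv⟩
  have := LinearMap.finrank_le_finrank_of_injective hf
  rwa [Module.finrank_fintype_fun_eq_card, Fintype.card_coe] at this

theorem maxNullity_le_zeroForcingNumber [Fintype V] (G : SimpleGraph V) :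
    maxNullity G ≤ zeroForcingNumber G := by
  obtain ⟨S, hS, hc⟩ := exists_progresses_card_eq G
  rw [← hc]
  refine csSup_le ((symmMatrices_nonempty G).image _) ?_
  rintro _ ⟨A, hA, rfl⟩
  exact nullity_le_card hS hA

theorem nullity_le_maxNullity [Fintype V] {A : Matrix V V ℝ} (hA : A ∈ symmMatrices G) :
    nullity A ≤ maxNullity G :=
  le_csSup ⟨Fintype.card V, by rintro _ ⟨A, -, rfl⟩; exact nullity_le A⟩ ⟨A, hA, rfl⟩

/-- In a cubic graph, the first vertex of a zero forcing triple that forces is adjacent to the other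
two vertices of the triple. -/
theorem Progresses.exists_first_force [Nonempty V] (hG : IsCubic G) {S : Finset V}
    (hS : Progresses G (S : Set V)) (hc : S.card = 3) :
    ∃ u y z v, (S : Set V) = {u, y, z} ∧ y ≠ z ∧ v ≠ u ∧ v ≠ y ∧ v ≠ z ∧
      ∀ w, G.Adj u w ↔ w = v ∨ w = y ∨ w = z := by
  classical
  have hne : (S : Set V) ≠ Set.univ := by
    intro h
    obtain ⟨v⟩ := ‹Nonempty V›
    obtain ⟨a, b, c, hab, hac, hbc, hw⟩ := hG v
    have hsub : ({v, a, b, c} : Finset V) ⊆ S := fun w _ => by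
      have : w ∈ (S : Set V) := h ▸ Set.mem_univ w
      exact this
    have hle := Finset.card_le_card hsub
    have ha := ((hw a).2 (by simp)).ne
    have hb := ((hw b).2 (by simp)).ne
    have hd := ((hw c).2 (by simp)).ne
    rw [Finset.card_insert_of_notMem (by simp [ha, hb, hd]),
      Finset.card_insert_of_notMem (by simp [hab, hac]),
      Finset.card_insert_of_notMem (by simp [hbc]), Finset.card_singleton] at hle
    omega
  obtain ⟨u, hu, v, hv, huv, hw⟩ := hS _ subset_rfl hne
  obtain ⟨y, z, hy, hz, hyz, hadj⟩ := hG.exists_second_third huv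
  have hyS : y ∈ S := (hw y ((hadj y).2 (by simp))).resolve_right hy
  have hzS : z ∈ S := (hw z ((hadj z).2 (by simp))).resolve_right hz
  have huy := ((hadj y).2 (by simp)).ne
  have huz := ((hadj z).2 (by simp)).ne
  have hEq : ({u, y, z} : Finset V) = S := by
    refine Finset.eq_of_subset_of_card_le ?_ ?_
    · intro w hw
      simp only [Finset.mem_insert, Finset.mem_singleton] at hw
      rcases hw with rfl | rfl | rfl
      exacts [hu, hyS, hzS]
    · rw [hc, Finset.card_insert_of_notMem (by simp [huy, huz]),
        Finset.card_insert_of_notMem (by simp [hyz]), Finset.card_singleton]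
  exact ⟨u, y, z, v, by rw [← hEq]; simp, hyz, huv.ne', hy.symm, hz.symm, hadj⟩

end Forcing

/-! ### Building a matrix of nullity three along the forces. -/

section Nullity

variable {V : Type*} [Fintype V] {G : SimpleGraph V}

/-- Some symmetric matrix with the pattern of `G` on `B` acts, after elimination of all vertices
other than `x`, `y`, `z`, as the symmetric `3 × 3` matrix with zero diagonal and with entries
`p`, `q`, `r` at `xy`, `xz`, `yz`. -/
def HasReduction (G : SimpleGraph V) (B : Set V) (x y z : V) (p q r : ℝ) : Prop :=
  ∃ A : Matrix V V ℝ, A.IsSymm ∧ (∀ i j, i ≠ j → (A i j ≠ 0 ↔ G.Adj i j ∧ i ∈ B ∧ j ∈ B)) ∧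
    (∀ i j, i ∉ B → A i j = 0) ∧
    ∀ a b c, ∃ s : V → ℝ, s x = a ∧ s y = b ∧ s z = c ∧
      A.mulVec s x = p * b + q * c ∧ A.mulVec s y = p * a + r * c ∧
      A.mulVec s z = q * a + r * b ∧ ∀ v, v ≠ x → v ≠ y → v ≠ z → A.mulVec s v = 0

theorem HasReduction.swap {B : Set V} {x y z : V} {p q r : ℝ}
    (h : HasReduction G B x y z p q r) : HasReduction G B y x z p r q := by
  obtain ⟨A, h1, h2, h3, h4⟩ := h
  refine ⟨A, h1, h2, h3, fun a b c => ?_⟩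
  obtain ⟨s, hx, hy, hz, ex, ey, ez, ev⟩ := h4 b a c
  exact ⟨s, hy, hx, hz, ey, ex, by rw [ez]; ring, fun v a b => ev v b a⟩

theorem HasReduction.swap' {B : Set V} {x y z : V} {p q r : ℝ}
    (h : HasReduction G B x y z p q r) : HasReduction G B z y x r q p := by
  obtain ⟨A, h1, h2, h3, h4⟩ := h
  refine ⟨A, h1, h2, h3, fun a b c => ?_⟩
  obtain ⟨s, hx, hy, hz, ex, ey, ez, ev⟩ := h4 c b a
  exact ⟨s, hz, hy, hx, by rw [ez]; ring, by rw [ey]; ring, by rw [ex]; ring,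
    fun v a b c => ev v c b a⟩

/-- Start of the construction: nothing has been eliminated, so the matrix is its own reduction. The
entry `r` may vanish here, since `y` and `z` need not be adjacent. -/
theorem hasReduction_triple {x y z : V} (hxy : G.Adj x y) (hxz : G.Adj x z) (hyz : y ≠ z)
    {r : ℝ} (hr : r ≠ 0 ↔ G.Adj y z) : HasReduction G {x, y, z} x y z 1 1 r := by
  classical
  have hyx := hxy.ne
  have hzx := hxz.ne
  refine ⟨Matrix.of fun i j => if i = x ∧ j = y ∨ i = y ∧ j = x ∨ i = x ∧ j = z ∨ i = z ∧ j = x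
      then 1 else if i = y ∧ j = z ∨ i = z ∧ j = y then r else 0, ?_, ?_, ?_, ?_⟩
  · ext i j
    simp only [Matrix.transpose_apply, Matrix.of_apply]
    congr 1
    · grind
    · congr 1
      grind
  · intro i j hij
    simp only [Matrix.of_apply, Set.mem_insert_iff, Set.mem_singleton_iff]
    have := G.adj_comm x y
    have := G.adj_comm x z
    have := G.adj_comm y z
    split_ifs with h h'
    · simp only [ne_eq, one_ne_zero, not_false_eq_true, true_iff]
      grind
    · grind
    · grind
  · intro i j hi
    simp only [Set.mem_insert_iff, Set.mem_singleton_iff, not_or] at hi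
    simp [Matrix.of_apply, hi]
  · intro a b c
    let s : V → ℝ := fun v => if v = x then a else if v = y then b else if v = z then c else 0
    have sx : s x = a := by simp [s]
    have sy : s y = b := by simp [s, hyx.symm]
    have sz : s z = c := by simp [s, hzx.symm, hyz.symm]
    have hsum : ∀ (t : V → ℝ), (∀ j, j ≠ x → j ≠ y → j ≠ z → t j = 0) →
        ∑ j, t j * s j = t x * a + t y * b + t z * c := by
      intro t ht
      rw [← sx, ← sy, ← sz, ← Finset.sum_subset (Finset.subset_univ {x, y, z})]
      · rw [Finset.sum_insert (by simp [hyx, hzx]), Finset.sum_insert (by simp [hyz]),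
          Finset.sum_singleton, add_assoc]
      · intro j _ hj
        simp only [Finset.mem_insert, Finset.mem_singleton, not_or] at hj
        rw [ht j hj.1 hj.2.1 hj.2.2, zero_mul]
    refine ⟨s, sx, sy, sz, ?_, ?_, ?_, ?_⟩
    · rw [Matrix.mulVec, dotProduct, hsum]
      · simp [hyx, hzx, hyx.symm, hzx.symm, hyz, hyz.symm]
      · intro j h1 h2 h3
        simp [h1, h2, h3]
    · rw [Matrix.mulVec, dotProduct, hsum]
      · simp [hyx, hzx, hyx.symm, hzx.symm, hyz, hyz.symm]
      · intro j h1 h2 h3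
        simp [h1, h2, h3]
    · rw [Matrix.mulVec, dotProduct, hsum]
      · simp [hyx, hzx, hyx.symm, hzx.symm, hyz, hyz.symm]
      · intro j h1 h2 h3
        simp [h1, h2, h3]
    · intro v h1 h2 h3
      rw [Matrix.mulVec, dotProduct, hsum]
      · simp [h1, h2, h3]
      · intro j h1 h2 h3
        simp [h1, h2, h3]

set_option linter.unusedSimpArgs false in
/-- Elimination of `x` when its last neighbor `x'` is added; `α` and `β` are the weights of `x'y`
and `x'z`, and `k` is the diagonal entry at `x`. -/
theorem HasReduction.force {B : Set V} {x y z x' : V} {p q r : ℝ}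
    (h : HasReduction G B x y z p q r) (hx : x ∈ B) (hy : y ∈ B) (hz : z ∈ B) (hx' : x' ∉ B)
    (hxy : x ≠ y) (hxz : x ≠ z) (hyz : y ≠ z) (hadj : G.Adj x x')
    (hB : ∀ u ∈ B, G.Adj u x' → u = x ∨ u = y ∨ u = z) {k α β : ℝ} (hk : k ≠ 0)
    (hα : α ≠ 0 ↔ G.Adj x' y) (hβ : β ≠ 0 ↔ G.Adj x' z) :
    HasReduction G (insert x' B) x' y z (α - p / k) (β - q / k) (r - p * q / k) := by
  classical
  obtain ⟨A, hsymm, hpat, hout, hsol⟩ := h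
  have hxx' : x ≠ x' := hadj.ne
  have hyx' : y ≠ x' := fun h => hx' (h ▸ hy)
  have hzx' : z ≠ x' := fun h => hx' (h ▸ hz)
  have hcol : ∀ i j, j ∉ B → A i j = 0 := fun i j hj => by rw [← hsymm.apply, hout j i hj]
  have hsing : ∀ (i j u v : V) (e : ℝ), Matrix.single i j e u v = if i = u ∧ j = v then e else 0 :=
    fun i j u v e => rfl
  -- Eliminating `x` subtracts `(1, p, q)ᵀ(1, p, q) / k` on `x'`, `y`, `z`; the diagonal entries `1
  -- / k`, `p ^ 2 / k`, `q ^ 2 / k` cancel the diagonal of this term.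
  refine ⟨A + Matrix.single x x k + Matrix.single x' x' (1 / k) + Matrix.single y y (p ^ 2 / k)
    + Matrix.single z z (q ^ 2 / k) + (Matrix.single x x' 1 + Matrix.single x' x 1)
    + (Matrix.single x' y α + Matrix.single y x' α)
    + (Matrix.single x' z β + Matrix.single z x' β), ?_, ?_, ?_, ?_⟩
  · rw [Matrix.IsSymm]
    simp only [Matrix.transpose_add, Matrix.transpose_single, hsymm.eq]
    abel
  · intro i j hij
    simp only [Matrix.add_apply, hsing, Set.mem_insert_iff]
    have hpij := hpat i j hij
    have hbi := hB i
    have hbj := hB j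
    have h1 := hout i j
    have h2 := hcol i j
    have hc1 := G.adj_comm i j
    have hd : ∀ (v : V) (e : ℝ), (if v = i ∧ v = j then e else 0) = 0 :=
      fun v e => if_neg fun h => hij (h.1.symm.trans h.2)
    simp only [hd, add_zero]
    by_cases hi : i = x'
    · subst hi
      have hj := hij.symm
      rw [h1 hx']
      by_cases jx : j = x
      · subst jx
        simp [hxx', hxx'.symm, hyx', hzx', hxy, hxz, hxy.symm, hxz.symm, hx, hadj.symm]
      by_cases jy : j = y
      · subst jy
        simp [hxx', hxx'.symm, hyx', hyx'.symm, hzx', hxy, hxz, hyz, hyz.symm, hy, hα]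
      by_cases jz : j = z
      · subst jz
        simp [hxx', hxx'.symm, hyx', hyx'.symm, hzx', hzx'.symm, hxy, hxz, hyz, hyz.symm, hz, hβ]
      · have : ¬ (G.Adj i j ∧ j ∈ B) := fun h => by
          rcases hbj h.2 h.1.symm with h | h | h <;> contradiction
        simp only [hxx', hyx', hzx', Ne.symm jx, Ne.symm jy, Ne.symm jz, and_false, false_and,
          if_false, add_zero, ne_eq, not_true_eq_false, true_or, true_and, hj, false_or, false_iff]
        exact this
    · by_cases hj : j = x'
      · subst hj
        rw [h2 hx']
        by_cases jx : i = x
        · subst jx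
          simp [hxx', hxx'.symm, hyx', hzx', hxy, hxz, hxy.symm, hxz.symm, hx, hadj]
        by_cases jy : i = y
        · subst jy
          simp [hxx', hxx'.symm, hyx', hyx'.symm, hzx', hxy, hxz, hyz, hyz.symm, hy, hα, hc1]
        by_cases jz : i = z
        · subst jz
          simp [hxx', hxx'.symm, hyx', hyx'.symm, hzx', hzx'.symm, hxy, hxz, hyz, hyz.symm, hz, hβ,
            hc1]
        · have : ¬ (G.Adj i j ∧ i ∈ B) := fun h => by
            rcases hbi h.2 h.1 with h | h | h <;> contradiction
          simp only [hxx', hyx', hzx', Ne.symm jx, Ne.symm jy, Ne.symm jz, and_false, false_and,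
            if_false, add_zero, ne_eq, not_true_eq_false, true_or, and_true, hi, false_or,
            false_iff]
          exact this
      · simp only [Ne.symm hi, Ne.symm hj, and_false, false_and, if_false, add_zero, hi, hj,
          false_or]
        exact hpij
  · intro i j hi
    simp only [Set.mem_insert_iff, not_or] at hi
    have ix : x ≠ i := fun h => hi.2 (h ▸ hx)
    have iy : y ≠ i := fun h => hi.2 (h ▸ hy)
    have iz : z ≠ i := fun h => hi.2 (h ▸ hz)
    simp [Matrix.add_apply, hsing, hout i j hi.2, ix, iy, iz, Ne.symm hi.1]
  · intro a b c
    -- The value at `x` is the solution of row `x`: `k * s x + a + p * b + q * c = 0`.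
    obtain ⟨s, sx, sy, sz, ex, ey, ez, ev⟩ := hsol (-(a + p * b + q * c) / k) b c
    have hA : A.mulVec (Function.update s x' a) = A.mulVec s := by
      funext i
      refine Finset.sum_congr rfl fun j _ => ?_
      by_cases hj : j = x'
      · change A i j * _ = A i j * _
        rw [hj, hcol i x' hx', zero_mul, zero_mul]
      · rw [Function.update_of_ne hj]
    have hAx' : A.mulVec s x' = 0 := ev x' hxx'.symm hyx'.symm hzx'.symm
    refine ⟨Function.update s x' a, by simp, by simp [hyx', sy], by simp [hzx', sz], ?_, ?_, ?_, ?_⟩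
    · simp only [Matrix.add_mulVec, Matrix.single_mulVec, Pi.add_apply, hA, hAx',
        Function.update_apply, hxx', hxx'.symm, hyx', hyx'.symm, hzx', hzx'.symm, if_true, if_false,
        Pi.zero_apply, sx, sy, sz]
      field_simp
      ring
    · simp only [Matrix.add_mulVec, Matrix.single_mulVec, Pi.add_apply, hA, ey,
        Function.update_apply, hyx', hxy.symm, hyz, if_true, if_false, Pi.zero_apply,
        sx, sy, sz]
      field_simp
      ring
    · simp only [Matrix.add_mulVec, Matrix.single_mulVec, Pi.add_apply, hA, ez,
        Function.update_apply, hzx', hxz.symm, hyz.symm, if_true, if_false, Pi.zero_apply,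
        sx, sy, sz]
      field_simp
      ring
    · intro v vx' vy vz
      by_cases vx : v = x
      · subst vx
        simp only [Matrix.add_mulVec, Matrix.single_mulVec, Pi.add_apply, hA, ex,
          Function.update_apply, vx', vy, vz, if_true, if_false, Pi.zero_apply,
          sx, sy, sz]
        field_simp
        ring
      · simp [Matrix.add_mulVec, Matrix.single_mulVec, hA, ev v vx vy vz,
          Function.update_apply, vx', vy, vz, vx]

/-- With zero reduction, every choice of values at `x`, `y`, `z` extends to a kernel vector, so the
kernel maps onto `ℝ³`. -/
theorem HasReduction.three_le_maxNullity {x y z : V}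
    (h : HasReduction G Set.univ x y z 0 0 0) :
    3 ≤ maxNullity G := by
  obtain ⟨A, hsymm, hpat, -, hsol⟩ := h
  have hA : A ∈ symmMatrices G := ⟨hsymm, fun i j hij => by simpa using hpat i j hij⟩
  refine le_trans ?_ (nullity_le_maxNullity hA)
  let f : LinearMap.ker A.mulVecLin →ₗ[ℝ] (Fin 3 → ℝ) :=
    (LinearMap.funLeft ℝ ℝ ![x, y, z]).comp (Submodule.subtype _)
  have hf : Function.Surjective f := by
    intro t
    obtain ⟨s, sx, sy, sz, ex, ey, ez, ev⟩ := hsol (t 0) (t 1) (t 2)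
    refine ⟨⟨s, ?_⟩, ?_⟩
    · rw [LinearMap.mem_ker, Matrix.mulVecLin_apply]
      funext v
      by_cases vx : v = x
      · rw [vx, ex]; simp
      by_cases vy : v = y
      · rw [vy, ey]; simp
      by_cases vz : v = z
      · rw [vz, ez]; simp
      · exact ev v vx vy vz
    · funext i
      fin_cases i
      · exact sx
      · exact sy
      · exact sz
  have := LinearMap.finrank_le_finrank_of_surjective hf
  simpa [nullity] using this

/-- The last vertex `x'` is adjacent to all of `x`, `y`, `z`, so both new weights may be any nonzero
numbers. Taking `k = p * q / r`, `α = p / k`, `β = q / k` annihilates the three entries. -/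
theorem HasReduction.three_le_maxNullity_of_force (hG : IsCubic G) {B : Set V} {x y z x' : V}
    {p q r : ℝ} (h : HasReduction G B x y z p q r) (hp : p ≠ 0) (hq : q ≠ 0) (hr : r ≠ 0)
    (hx : x ∈ B) (hy : y ∈ B) (hz : z ∈ B) (hx' : x' ∉ B)
    (hxy : x ≠ y) (hxz : x ≠ z) (hyz : y ≠ z) (hadj : G.Adj x x')
    (hB : ∀ u ∈ B, G.Adj u x' → u = x ∨ u = y ∨ u = z) (huniv : insert x' B = Set.univ) :
    3 ≤ maxNullity G := by
  have hmem : ∀ w, G.Adj x' w → w = x ∨ w = y ∨ w = z := fun w hw => by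
    have : w ∈ insert x' B := huniv ▸ Set.mem_univ w
    exact hB w (this.resolve_left hw.ne') hw.symm
  have hall : ∀ a b, ∃ w, G.Adj x' w ∧ w ≠ a ∧ w ≠ b := hG.exists_ne x'
  have hy' : G.Adj x' y := by
    obtain ⟨w, hw, h1, h2⟩ := hall x z
    rcases hmem w hw with rfl | rfl | rfl <;> trivial
  have hz' : G.Adj x' z := by
    obtain ⟨w, hw, h1, h2⟩ := hall x y
    rcases hmem w hw with rfl | rfl | rfl <;> trivial
  have hk : p * q / r ≠ 0 := by positivity
  have h1 : p / (p * q / r) ≠ 0 := div_ne_zero hp hk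
  have h2 : q / (p * q / r) ≠ 0 := div_ne_zero hq hk
  have key := h.force hx hy hz hx' hxy hxz hyz hadj hB hk (α := p / (p * q / r))
    (β := q / (p * q / r)) (by simpa [hy'] using h1) (by simpa [hz'] using h2)
  rw [huniv, sub_self, sub_self, show r - p * q / (p * q / r) = 0 by field_simp; ring] at key
  exact key.three_le_maxNullity

theorem HasReduction.exists_force {B : Set V} {x y z x' : V}
    {p q r : ℝ} (h : HasReduction G B x y z p q r) (hp : p ≠ 0) (hq : q ≠ 0)
    (hx : x ∈ B) (hy : y ∈ B) (hz : z ∈ B) (hx' : x' ∉ B)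
    (hxy : x ≠ y) (hxz : x ≠ z) (hyz : y ≠ z) (hadj : G.Adj x x')
    (hB : ∀ u ∈ B, G.Adj u x' → u = x ∨ u = y ∨ u = z) :
    ∃ p' q' r', p' ≠ 0 ∧ q' ≠ 0 ∧ r' ≠ 0 ∧ HasReduction G (insert x' B) x' y z p' q' r' := by
  -- Only `k = p * q / r` is to be avoided; twice that value leaves `r / 2`.
  obtain ⟨k, hk, hkr⟩ : ∃ k : ℝ, k ≠ 0 ∧ r - p * q / k ≠ 0 := by
    by_cases hr : r = 0
    · exact ⟨1, one_ne_zero, by simp [hr, hp, hq]⟩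
    · refine ⟨2 * (p * q / r), by positivity, ?_⟩
      rw [show r - p * q / (2 * (p * q / r)) = r / 2 by field_simp; ring]
      positivity
  -- Weight `2 * t` on an edge leaves `t`, and weight `0` on a nonedge leaves `-t`; both are
  -- nonzero.
  have hw : ∀ (t : ℝ) (P : Prop), t ≠ 0 → ∃ a : ℝ, (a ≠ 0 ↔ P) ∧ a - t ≠ 0 := by
    intro t P ht
    by_cases hP : P
    · exact ⟨2 * t, by simp [hP, ht], by rw [two_mul, add_sub_cancel_right]; exact ht⟩
    · exact ⟨0, by simp [hP], by simpa using ht⟩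
  obtain ⟨α, hα, hα'⟩ := hw (p / k) (G.Adj x' y) (div_ne_zero hp hk)
  obtain ⟨β, hβ, hβ'⟩ := hw (q / k) (G.Adj x' z) (div_ne_zero hq hk)
  exact ⟨_, _, _, hα', hβ', hkr, h.force hx hy hz hx' hxy hxz hyz hadj hB hk hα hβ⟩

/-- The forcing vertex has `v` as its only outside neighbor, so `v` replaces it in the boundary
triple. The symmetries of the reduction let any of the three force. -/
theorem HasReduction.three_le_maxNullity_of_progresses (hG : IsCubic G) {S : Set V}
    (hS : Progresses G S) (B : Set V) : S ⊆ B → B ≠ Set.univ → ∀ x y z p q r,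
    HasReduction G B x y z p q r → p ≠ 0 → q ≠ 0 → r ≠ 0 → x ∈ B → y ∈ B → z ∈ B →
    x ≠ y → x ≠ z → y ≠ z →
    (∀ u ∈ B, ∀ w, w ∉ B → G.Adj u w → u = x ∨ u = y ∨ u = z) → 3 ≤ maxNullity G := by
  induction B using set_induction_compl with
  | _ B ih =>
  intro hSB hB x y z p q r h hp hq hr hx hy hz hxy hxz hyz hact
  obtain ⟨u, hu, v, hv, huv, hw⟩ := hS B hSB hB
  have main : ∀ x y z p q r, u = x →
      HasReduction G B x y z p q r → p ≠ 0 → q ≠ 0 → r ≠ 0 → x ∈ B → y ∈ B → z ∈ B →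
      x ≠ y → x ≠ z → y ≠ z →
      (∀ u ∈ B, ∀ w, w ∉ B → G.Adj u w → u = x ∨ u = y ∨ u = z) → 3 ≤ maxNullity G := by
    rintro x y z p q r rfl h hp hq hr hx hy hz hxy hxz hyz hact
    by_cases huniv : insert v B = Set.univ
    · exact h.three_le_maxNullity_of_force hG hp hq hr hx hy hz hv hxy hxz hyz huv
        (fun a ha => hact a ha v hv) huniv
    · obtain ⟨p', q', r', hp', hq', hr', h'⟩ := h.exists_force hp hq hx hy hz hv hxy hxz hyz huv
        (fun a ha => hact a ha v hv)
      refine ih _ (Set.ssubset_insert hv) (hSB.trans (Set.subset_insert _ _)) huniv _ _ _ _ _ _ h'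
        hp' hq' hr' (Set.mem_insert _ _) (Set.mem_insert_of_mem _ hy) (Set.mem_insert_of_mem _ hz)
        (fun h => hv (h ▸ hy)) (fun h => hv (h ▸ hz)) hyz ?_
      intro a ha w hwB haw
      simp only [Set.mem_insert_iff, not_or] at ha hwB
      rcases ha with rfl | ha
      · exact Or.inl rfl
      · rcases hact a ha w hwB.2 haw with rfl | h | h
        · rcases hw w haw with h | h
          · exact absurd h hwB.2
          · exact absurd h hwB.1
        · exact Or.inr (Or.inl h)
        · exact Or.inr (Or.inr h)
  rcases hact u hu v hv huv with h0 | h0 | h0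
  · exact main x y z p q r h0 h hp hq hr hx hy hz hxy hxz hyz hact
  · exact main y x z p r q h0 h.swap hp hr hq hy hx hz hxy.symm hyz hxz
      (fun u hu w hw ha => by have := hact u hu w hw ha; tauto)
  · exact main z y x r q p h0 h.swap' hr hq hp hz hy hx hyz.symm hxz.symm hxy.symm
      (fun u hu w hw ha => by have := hact u hu w hw ha; tauto)

theorem three_le_maxNullity [Nonempty V] (hG : IsCubic G) {S : Finset V}
    (hS : Progresses G (S : Set V)) (hc : S.card = 3) : 3 ≤ maxNullity G := by
  classical
  obtain ⟨u, y, z, v, hSe, hyz, hvu, hvy, hvz, hadj⟩ := hS.exists_first_force hG hc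
  have huv := (hadj v).2 (by simp)
  have huy := (hadj y).2 (by simp)
  have huz := (hadj z).2 (by simp)
  rw [hSe] at hS
  have hact : ∀ a ∈ ({u, y, z} : Set V), a = u ∨ a = y ∨ a = z := fun a ha => by simpa using ha
  have h := hasReduction_triple (G := G) huy huz hyz (r := if G.Adj y z then 1 else 0) (by simp)
  have hv : v ∉ ({u, y, z} : Set V) := by simp [hvu, hvy, hvz]
  by_cases huniv : insert v ({u, y, z} : Set V) = Set.univ
  · refine h.three_le_maxNullity_of_force hG one_ne_zero one_ne_zero ?_ (by simp) (by simp)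
      (by simp) hv huy.ne huz.ne hyz huv (fun a ha _ => hact a ha) huniv
    -- Here the graph has only the four vertices `v`, `u`, `y`, `z`, so the neighbor of `y` other
    -- than `u` and `v` is `z`.
    have : G.Adj y z := by
      obtain ⟨w, hw, h1, h2⟩ := hG.exists_ne y u v
      have hmem : w ∈ insert v ({u, y, z} : Set V) := huniv ▸ Set.mem_univ w
      simp only [Set.mem_insert_iff, Set.mem_singleton_iff] at hmem
      rcases hmem with rfl | rfl | rfl | rfl
      · contradiction
      · contradiction
      · exact absurd hw (G.irrefl)
      · exact hw
    simp [this]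
  · obtain ⟨p', q', r', hp', hq', hr', h'⟩ := h.exists_force one_ne_zero one_ne_zero (by simp)
      (by simp) (by simp) hv huy.ne huz.ne hyz huv (fun a ha _ => hact a ha)
    refine HasReduction.three_le_maxNullity_of_progresses hG hS _ (Set.subset_insert _ _) huniv
      _ _ _ _ _ _ h' hp' hq' hr' (by simp) (by simp) (by simp) hvy hvz hyz ?_
    intro a ha w hw haw
    simp only [Set.mem_insert_iff, Set.mem_singleton_iff, not_or] at ha hw
    rcases ha with rfl | rfl | rfl | rfl
    · simp
    · rcases (hadj w).1 haw with rfl | rfl | rfl <;> simp at hw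
    · simp
    · simp

end Nullity

/-! ### Adjacency and ports in the blocks, cones and compounds. -/

section Adjacency

theorem ladder_adj {n : ℕ} {a b : Fin (n + 1) × Bool} :
    (ladder n).Adj a b ↔ ((a.1 : ℕ) = b.1 ∧ a.2 ≠ b.2) ∨ ((a.1 : ℕ) + 1 = b.1 ∧ a.2 = b.2) ∨
      ((b.1 : ℕ) + 1 = a.1 ∧ a.2 = b.2) := by
  obtain ⟨⟨i, hi⟩, s⟩ := a
  obtain ⟨⟨j, hj⟩, t⟩ := b
  simp only [ladder, SimpleGraph.fromRel_adj, Fin.mk.injEq, ne_eq, Prod.mk.injEq]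
  grind

@[simp] theorem graphM_adj_inl_inl {n : ℕ} {a b : Fin (n + 1) × Bool} :
    (graphM n).Adj (Sum.inl a) (Sum.inl b) ↔ (ladder n).Adj a b := by
  simp only [graphM, SimpleGraph.fromRel_adj, (ladder n).adj_comm b a, or_self, ne_eq,
    Sum.inl.injEq, and_iff_right_iff_imp]
  exact fun h => h.ne

@[simp] theorem graphM_adj_inl_inr {n : ℕ} {a : Fin (n + 1) × Bool} {t : Bool} :
    (graphM n).Adj (Sum.inl a) (Sum.inr t) ↔ a = (Fin.last n, false) ∧ t = false := by
  simp [graphM]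

@[simp] theorem graphM_adj_inr_inl {n : ℕ} {a : Fin (n + 1) × Bool} {t : Bool} :
    (graphM n).Adj (Sum.inr t) (Sum.inl a) ↔ a = (Fin.last n, false) ∧ t = false := by
  simp [graphM]

@[simp] theorem graphM_adj_inr_inr {n : ℕ} {s t : Bool} :
    (graphM n).Adj (Sum.inr s) (Sum.inr t) ↔ s ≠ t := by
  cases s <;> cases t <;> simp [graphM]

@[simp] theorem graphT_adj_inl_inl {n : ℕ} {a b : Fin (n + 1) × Bool} :
    (graphT n).Adj (Sum.inl a) (Sum.inl b) ↔ (ladder n).Adj a b := by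
  simp only [graphT, SimpleGraph.fromRel_adj, (ladder n).adj_comm b a, or_self, ne_eq,
    Sum.inl.injEq, and_iff_right_iff_imp]
  exact fun h => h.ne

@[simp] theorem graphT_adj_inl_inr {n : ℕ} {a : Fin (n + 1) × Bool} {t : Unit} :
    (graphT n).Adj (Sum.inl a) (Sum.inr t) ↔ a.1 = Fin.last n := by
  simp [graphT]

@[simp] theorem graphT_adj_inr_inl {n : ℕ} {a : Fin (n + 1) × Bool} {t : Unit} :
    (graphT n).Adj (Sum.inr t) (Sum.inl a) ↔ a.1 = Fin.last n := by
  simp [graphT]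

@[simp] theorem not_graphT_adj_inr_inr {n : ℕ} {s t : Unit} :
    ¬ (graphT n).Adj (Sum.inr s) (Sum.inr t) := by
  simp

variable {V V' : Type} {G : SimpleGraph V} {G' : SimpleGraph V'} {P : Set V} {A : Set V}
  {B : Set V'} {f : A ≃ B}

@[simp] theorem coneGraph_adj_some_some {a b : V} :
    (coneGraph G P).Adj (some a) (some b) ↔ G.Adj a b := by
  simp only [coneGraph, SimpleGraph.fromRel_adj, G.adj_comm b a, or_self, ne_eq,
    Option.some.injEq, and_iff_right_iff_imp]
  exact fun h => h.ne

@[simp] theorem coneGraph_adj_none_some {b : V} :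
    (coneGraph G P).Adj none (some b) ↔ b ∈ P := by
  simp [coneGraph]

@[simp] theorem coneGraph_adj_some_none {b : V} :
    (coneGraph G P).Adj (some b) none ↔ b ∈ P := by
  simp [coneGraph]

@[simp] theorem compoundGraph_adj_inl_inl {a b : V} :
    (compoundGraph G G' f).Adj (Sum.inl a) (Sum.inl b) ↔ G.Adj a b := by
  simp only [compoundGraph, SimpleGraph.fromRel_adj, G.adj_comm b a, or_self, ne_eq,
    Sum.inl.injEq, and_iff_right_iff_imp]
  exact fun h => h.ne

@[simp] theorem compoundGraph_adj_inr_inr {a b : V'} :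
    (compoundGraph G G' f).Adj (Sum.inr a) (Sum.inr b) ↔ G'.Adj a b := by
  simp only [compoundGraph, SimpleGraph.fromRel_adj, G'.adj_comm b a, or_self, ne_eq,
    Sum.inr.injEq, and_iff_right_iff_imp]
  exact fun h => h.ne

@[simp] theorem compoundGraph_adj_inl_inr {a : V} {b : V'} :
    (compoundGraph G G' f).Adj (Sum.inl a) (Sum.inr b) ↔ ∃ ha : a ∈ A, (f ⟨a, ha⟩ : V') = b := by
  simp [compoundGraph]

@[simp] theorem compoundGraph_adj_inr_inl {a : V} {b : V'} :
    (compoundGraph G G' f).Adj (Sum.inr b) (Sum.inl a) ↔ ∃ ha : a ∈ A, (f ⟨a, ha⟩ : V') = b := by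
  simp [compoundGraph]

theorem ncard_neighborSet_ne_one {v a b : V} (ha : G.Adj v a) (hb : G.Adj v b) (hab : a ≠ b) :
    (G.neighborSet v).ncard ≠ 1 := by
  intro h
  obtain ⟨c, hc⟩ := Set.ncard_eq_one.1 h
  have h1 : a ∈ G.neighborSet v := ha
  have h2 : b ∈ G.neighborSet v := hb
  rw [hc] at h1 h2
  exact hab (h1.trans h2.symm)

/-- The tail end is the only pendant vertex that is not already yellow; the pendant top vertex of `M
0` is yellow. -/
theorem M_ports (n : ℕ) :
    (M n).ports = {Sum.inl (0, true), Sum.inl (0, false), Sum.inr true} := by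
  ext v
  simp only [ColoredGraph.ports, Set.mem_ofPred_eq, Set.mem_insert_iff, Set.mem_singleton_iff]
  rcases v with ⟨⟨i, hi⟩, s⟩ | t
  · rcases i with _ | i
    · cases s <;> simp
    · have : ((graphM n).neighborSet (Sum.inl (⟨i + 1, hi⟩, s))).ncard ≠ 1 :=
        ncard_neighborSet_ne_one (a := Sum.inl (⟨i + 1, hi⟩, !s))
          (b := Sum.inl (⟨i, by omega⟩, s)) (by simp [ladder_adj]) (by simp [ladder_adj]) (by simp)
      simp [this, Fin.ext_iff]
  · cases t
    · have : ((graphM n).neighborSet (Sum.inr false)).ncard ≠ 1 :=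
        ncard_neighborSet_ne_one (a := Sum.inl (Fin.last n, false))
          (b := Sum.inr true) (by simp) (by simp) (by simp)
      simp [this]
    · have : (graphM n).neighborSet (Sum.inr true) = {Sum.inr false} := by
        ext w
        rcases w with w | w <;> simp
      simp [this]

theorem T_ports (n : ℕ) :
    (T n).ports = {Sum.inl (0, true), Sum.inl (0, false), Sum.inr ()} := by
  ext v
  simp only [ColoredGraph.ports, Set.mem_ofPred_eq, Set.mem_insert_iff, Set.mem_singleton_iff]
  rcases v with ⟨⟨i, hi⟩, s⟩ | t
  · rcases i with _ | i
    · cases s <;> simp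
    · have : ((graphT n).neighborSet (Sum.inl (⟨i + 1, hi⟩, s))).ncard ≠ 1 :=
        ncard_neighborSet_ne_one (a := Sum.inl (⟨i + 1, hi⟩, !s))
          (b := Sum.inl (⟨i, by omega⟩, s)) (by simp [ladder_adj]) (by simp [ladder_adj]) (by simp)
      simp [this, Fin.ext_iff]
  · simp

/-- The left part of a compound. -/
def compoundInl (H K : ColoredGraph) (f : H.white ≃ K.ports) :
    H.graph ↪g (compound H K f).graph where
  toFun := Sum.inl
  inj' := Sum.inl_injective
  map_rel_iff' := compoundGraph_adj_inl_inl

/-- The right part of a compound. -/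
def compoundInr (H K : ColoredGraph) (f : H.white ≃ K.ports) :
    K.graph ↪g (compound H K f).graph where
  toFun := Sum.inr
  inj' := Sum.inr_injective
  map_rel_iff' := compoundGraph_adj_inr_inr

/-- The base of a cone. -/
def coneSome (H : ColoredGraph) : H.graph ↪g (cone H).graph where
  toFun := some
  inj' := Option.some_injective _
  map_rel_iff' := coneGraph_adj_some_some

/-- The ladder in `M n`. -/
def ladderM (n : ℕ) : ladder n ↪g (M n).graph where
  toFun := Sum.inl
  inj' := Sum.inl_injective
  map_rel_iff' := graphM_adj_inl_inl

/-- The ladder in `T n`. -/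
def ladderT (n : ℕ) : ladder n ↪g (T n).graph where
  toFun := Sum.inl
  inj' := Sum.inl_injective
  map_rel_iff' := graphT_adj_inl_inl

end Adjacency

/-! ### Recognizing cones and compounds inside a given graph. -/

section Prefix

variable {V : Type*} {G : SimpleGraph V}

/-- The vertices of `B` form a single vertex or a chain that can be continued by any block `K`
attached with its ports at `P`. -/
def Extends (G : SimpleGraph V) (B P : Set V) : Prop :=
  ∀ (K : ColoredGraph) (ψ : K.graph ↪g G), Disjoint B (Set.range ψ) → ψ '' K.ports = P →
    ∃ H : ColoredGraph,
      (H = cone K ∨ ∃ H', IsMChain H' ∧ ∃ f : H'.white ≃ K.ports, H = compound H' K f) ∧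
      ∃ φ : H.graph ↪g G, Set.range φ = B ∪ Set.range ψ ∧ φ '' H.white = ψ '' K.white

theorem extends_singleton {u : V} {P : Set V} (hP : ∀ w, G.Adj u w ↔ w ∈ P) :
    Extends G {u} P := by
  intro K ψ hdisj hports
  have hu : ∀ k, ψ k ≠ u := fun k h =>
    Set.disjoint_left.1 hdisj (Set.mem_singleton u) ⟨k, h⟩
  have hadj : ∀ k, G.Adj u (ψ k) ↔ k ∈ K.ports := by
    intro k
    rw [hP, ← hports]
    exact ψ.injective.mem_set_image
  refine ⟨cone K, Or.inl rfl, ⟨⟨fun o => o.elim u ψ, ?_⟩, ?_⟩, ?_, ?_⟩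
  · rintro (_ | a) (_ | b) h
    · rfl
    · exact absurd h.symm (hu b)
    · exact absurd h (hu a)
    · exact congrArg some (ψ.injective h)
  · rintro (_ | a) (_ | b)
    · simp
    · exact (hadj b).trans coneGraph_adj_none_some.symm
    · exact ((G.adj_comm _ _).trans (hadj a)).trans coneGraph_adj_some_none.symm
    · exact ψ.map_adj_iff.trans coneGraph_adj_some_some.symm
  · ext w
    constructor
    · rintro ⟨_ | a, rfl⟩
      · exact Or.inl rfl
      · exact Or.inr ⟨a, rfl⟩
    · rintro (rfl | ⟨a, rfl⟩)
      · exact ⟨none, rfl⟩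
      · exact ⟨some a, rfl⟩
  · exact Set.image_image _ _ _

/-- All edges leaving the chain run from a white vertex `u` to `g u`. Once the images of these edges
are the ports of `K`, the injective map `g` is the bijection that defines the compound. -/
theorem extends_of_isMChain {H : ColoredGraph} (hH : IsMChain H) (φ : H.graph ↪g G) {g : V → V}
    (hinj : Set.InjOn g (φ '' H.white))
    (hadj : ∀ u ∈ Set.range φ, ∀ w, w ∉ Set.range φ →
      (G.Adj u w ↔ u ∈ φ '' H.white ∧ w = g u)) :
    Extends G (Set.range φ) (g '' (φ '' H.white)) := by
  intro K ψ hdisj hports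
  have hout : ∀ k, ψ k ∉ Set.range φ := fun k h => Set.disjoint_left.1 hdisj h ⟨k, rfl⟩
  have hex : ∀ h : H.white, ∃ k : K.ports, ψ k = g (φ h) := by
    intro h
    have : g (φ h) ∈ ψ '' K.ports := hports ▸ ⟨_, ⟨_, h.2, rfl⟩, rfl⟩
    obtain ⟨k, hk, he⟩ := this
    exact ⟨⟨k, hk⟩, he⟩
  choose f hf using hex
  have hbij : Function.Bijective f := by
    constructor
    · intro a b hab
      have : g (φ a) = g (φ b) := by rw [← hf, ← hf, hab]
      exact Subtype.ext (φ.injective (hinj ⟨_, a.2, rfl⟩ ⟨_, b.2, rfl⟩ this))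
    · intro k
      have : ψ k ∈ g '' (φ '' H.white) := hports ▸ ⟨_, k.2, rfl⟩
      obtain ⟨_, ⟨h, hh, rfl⟩, he⟩ := this
      exact ⟨⟨h, hh⟩, Subtype.ext (ψ.injective ((hf ⟨h, hh⟩).trans he))⟩
  have hcross : ∀ h k, G.Adj (φ h) (ψ k) ↔ ∃ ha : h ∈ H.white, (f ⟨h, ha⟩ : K.V) = k := by
    intro h k
    rw [hadj _ ⟨h, rfl⟩ _ (hout k), φ.injective.mem_set_image]
    constructor
    · rintro ⟨ha, he⟩
      exact ⟨ha, ψ.injective ((hf ⟨h, ha⟩).trans he.symm)⟩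
    · rintro ⟨ha, rfl⟩
      exact ⟨ha, hf ⟨h, ha⟩⟩
  refine ⟨compound H K (Equiv.ofBijective f hbij), Or.inr ⟨H, hH, _, rfl⟩,
    ⟨⟨Sum.elim φ ψ, ?_⟩, ?_⟩, ?_, ?_⟩
  · refine Function.Injective.sumElim φ.injective ψ.injective fun a b h => hout b ⟨a, h⟩
  · rintro (a | a) (b | b)
    · simp
    · simpa using hcross a b
    · simpa [G.adj_comm] using hcross b a
    · simp
  · exact Set.Sum.elim_range _ _
  · exact Set.image_image _ _ _

theorem Extends.exists_isMChain {B P : Set V} (h : Extends G B P) {n : ℕ}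
    (ψ : (M n).graph ↪g G) (hdisj : Disjoint B (Set.range ψ)) (hports : ψ '' (M n).ports = P) :
    ∃ H, IsMChain H ∧
      ∃ φ : H.graph ↪g G, Set.range φ = B ∪ Set.range ψ ∧ φ '' H.white = ψ '' (M n).white := by
  obtain ⟨H, rfl | ⟨H', hH', f, rfl⟩, φ, hφ⟩ := h (M n) ψ hdisj hports
  · exact ⟨_, .base n, φ, hφ⟩
  · exact ⟨_, .step hH' n f, φ, hφ⟩

theorem Extends.inFamily {B P : Set V} (h : Extends G B P) {m : ℕ}
    (ψ : (T m).graph ↪g G) (hdisj : Disjoint B (Set.range ψ)) (hports : ψ '' (T m).ports = P)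
    (huniv : B ∪ Set.range ψ = Set.univ) : InFamily G := by
  obtain ⟨H, hH, φ, hφ, -⟩ := h (T m) ψ hdisj hports
  rw [huniv, Set.range_eq_univ] at hφ
  rcases hH with rfl | ⟨H', hH', f, rfl⟩
  · exact Or.inl ⟨m, ⟨(RelIso.ofSurjective φ hφ).symm⟩⟩
  · exact Or.inr ⟨H', hH', m, f, ⟨(RelIso.ofSurjective φ hφ).symm⟩⟩

end Prefix

/-! ### Members of the family are forced by three vertices. -/

section FamilyForcing

variable {V : Type*} {G : SimpleGraph V}

/-- No vertex of `C` can force a vertex outside `C`. -/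
def ForceClosed (G : SimpleGraph V) (C : Set V) : Prop :=
  ∀ u ∈ C, ∀ v, G.Adj u v → (∀ w, G.Adj u w → w ∈ C ∨ w = v) → v ∈ C

theorem progresses_of_forceClosed {S : Set V}
    (h : ∀ C, S ⊆ C → ForceClosed G C → C = Set.univ) : Progresses G S := by
  intro B hSB hB
  by_contra hcon
  push Not at hcon
  refine hB (h B hSB fun u hu v huv hw => ?_)
  by_contra hv
  obtain ⟨w, hw1, hw2, hw3⟩ := hcon u hu v hv huv
  exact (hw w hw1).elim hw2 hw3

/-- Once rung `i` is black, each of its vertices has only its successor on the same side left to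
force. -/
theorem ForceClosed.ladder {C : Set V} (hC : ForceClosed G C) {n : ℕ} (φ : ladder n ↪g G)
    (h0 : ∀ s, φ (0, s) ∈ C)
    (hnb : ∀ i s, i ≠ Fin.last n → ∀ w, G.Adj (φ (i, s)) w → w ∈ C ∨ w ∈ Set.range φ) :
    Set.range φ ⊆ C := by
  have key : ∀ i (hi : i < n + 1) s, φ (⟨i, hi⟩, s) ∈ C := by
    intro i
    induction i using Nat.strong_induction_on with
    | _ i ih =>
    intro hi s
    rcases i with _ | i
    · exact h0 s
    · refine hC _ (ih i (Nat.lt_succ_self i) (by omega) s) _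
        (φ.map_adj_iff.2 (by simp [ladder_adj])) fun w hw => ?_
      rcases hnb _ _ (by simp [Fin.ext_iff]; omega) w hw with h | ⟨⟨⟨j, hj⟩, t⟩, rfl⟩
      · exact Or.inl h
      · rw [φ.map_adj_iff, ladder_adj] at hw
        simp only at hw
        rcases hw with ⟨rfl, -⟩ | ⟨h1, h2⟩ | ⟨h1, h2⟩
        · exact Or.inl (ih _ (Nat.lt_succ_self _) _ _)
        · subst h1 h2
          exact Or.inr rfl
        · exact Or.inl (ih j (by omega) _ _)
  rintro _ ⟨⟨i, s⟩, rfl⟩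
  exact key i i.2 s

/-- The ladder fills up from its first rung, then its last bottom vertex forces `c`; `d` is itself a
port. White vertices are exempt from `hnb` because they may have neighbors in the next block. -/
theorem ForceClosed.blockM {C : Set V} (hC : ForceClosed G C) {n : ℕ} (φ : (M n).graph ↪g G)
    (hports : φ '' (M n).ports ⊆ C)
    (hnb : ∀ k, k ∉ (M n).white → ∀ w, G.Adj (φ k) w → w ∈ C ∨ w ∈ Set.range φ) :
    Set.range φ ⊆ C := by
  rw [M_ports, Set.image_subset_iff] at hports
  have hd : φ (Sum.inr true) ∈ C := hports (by simp)
  have hlad : ∀ a, φ (Sum.inl a) ∈ C := by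
    have := hC.ladder ((ladderM n).trans φ) (fun s => by cases s <;> exact hports (by simp [ladderM]))
      (fun i s hi w hw => ?_)
    · exact fun a => this ⟨a, rfl⟩
    · rcases hnb (Sum.inl (i, s)) (by simp [hi]) w hw with h | ⟨k | t, rfl⟩
      · exact Or.inl h
      · exact Or.inr ⟨k, rfl⟩
      · exact absurd (congrArg Prod.fst (graphM_adj_inl_inr.1 (φ.map_adj_iff.1 hw)).1) hi
  have hc : φ (Sum.inr false) ∈ C := by
    refine hC _ (hlad (Fin.last n, false)) _ (φ.map_adj_iff.2 (by simp)) fun w hw => ?_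
    rcases hnb _ (by simp) w hw with h | ⟨k | t, rfl⟩
    · exact Or.inl h
    · exact Or.inl (hlad k)
    · have := φ.map_adj_iff.1 hw
      simp only [graphM_adj_inl_inr, true_and] at this
      exact Or.inr (by rw [this])
  rintro _ ⟨k | t, rfl⟩
  · exact hlad k
  · cases t
    exacts [hc, hd]

theorem ForceClosed.blockT {C : Set V} (hC : ForceClosed G C) {n : ℕ} (φ : (T n).graph ↪g G)
    (hports : φ '' (T n).ports ⊆ C)
    (hnb : ∀ k, ∀ w, G.Adj (φ k) w → w ∈ C ∨ w ∈ Set.range φ) :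
    Set.range φ ⊆ C := by
  rw [T_ports, Set.image_subset_iff] at hports
  have hlad : ∀ a, φ (Sum.inl a) ∈ C := by
    have := hC.ladder ((ladderT n).trans φ) (fun s => by cases s <;> exact hports (by simp [ladderT]))
      (fun i s hi w hw => ?_)
    · exact fun a => this ⟨a, rfl⟩
    · rcases hnb (Sum.inl (i, s)) w hw with h | ⟨k | t, rfl⟩
      · exact Or.inl h
      · exact Or.inr ⟨k, rfl⟩
      · exact absurd (graphT_adj_inl_inr.1 (φ.map_adj_iff.1 hw)) hi
  rintro _ ⟨k | t, rfl⟩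
  · exact hlad k
  · exact hports (by simp)

/-- A white vertex of `H` has its partner under `f` as its only neighbor outside `H`, so it forces
that port. -/
theorem ForceClosed.compound_ports {C : Set V} (hC : ForceClosed G C) {H K : ColoredGraph}
    {f : H.white ≃ K.ports} (φ : (compound H K f).graph ↪g G)
    (hH : Set.range (φ.comp (compoundInl H K f)) ⊆ C)
    (hnb : ∀ h w, G.Adj (φ (Sum.inl h)) w → w ∈ Set.range φ) :
    (φ.comp (compoundInr H K f)) '' K.ports ⊆ C := by
  rintro _ ⟨k, hk, rfl⟩
  obtain ⟨⟨h, hh⟩, hf⟩ := f.surjective ⟨k, hk⟩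
  have hfk : (f ⟨h, hh⟩ : K.V) = k := congrArg Subtype.val hf
  refine hC (φ (Sum.inl h)) (hH ⟨h, rfl⟩) _
    (φ.map_adj_iff.2 (compoundGraph_adj_inl_inr.2 ⟨hh, hfk⟩)) fun w hw => ?_
  obtain ⟨a | a, rfl⟩ := hnb h w hw
  · exact Or.inl (hH ⟨a, rfl⟩)
  · obtain ⟨_, h'⟩ := compoundGraph_adj_inl_inr.1 (φ.map_adj_iff.1 hw)
    rw [← h', hfk]
    exact Or.inr rfl

theorem compound_inl_outside {H K : ColoredGraph} {f : H.white ≃ K.ports}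
    (φ : (compound H K f).graph ↪g G) (hnb : ∀ h w, G.Adj (φ (Sum.inl h)) w → w ∈ Set.range φ)
    (h : H.V) (w : V) (hw : w ∉ Set.range (φ.comp (compoundInl H K f)))
    (hadj : G.Adj (φ (Sum.inl h)) w) : ∃ hh : h ∈ H.white, w = φ (Sum.inr (f ⟨h, hh⟩)) := by
  obtain ⟨a | a, rfl⟩ := hnb h w hadj
  · exact absurd ⟨a, rfl⟩ hw
  · obtain ⟨hh, h'⟩ := compoundGraph_adj_inl_inr.1 (φ.map_adj_iff.1 hadj)
    exact ⟨hh, by rw [h']⟩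

/-- The triple is the apex and the first rung of the first block. It is fixed before the embedding,
so that the induction can apply it to the left part of a compound. -/
theorem IsMChain.exists_forcing_triple {H : ColoredGraph} (hH : IsMChain H) :
    ∃ a b c : H.V, ∀ φ : H.graph ↪g G,
      (∀ h w, w ∉ Set.range φ → G.Adj (φ h) w →
        h ∈ H.white ∧ ∀ w', w' ∉ Set.range φ → G.Adj (φ h) w' → w' = w) →
      ∀ C, ForceClosed G C → φ a ∈ C → φ b ∈ C → φ c ∈ C → Set.range φ ⊆ C := by
  induction hH with
  | base n =>
    refine ⟨none, some (Sum.inl (0, true)), some (Sum.inl (0, false)), ?_⟩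
    intro φ hnb C hC ha hb hc
    -- The apex is adjacent only to the three ports, two of which are already in `C`.
    have hd : φ (some (Sum.inr true)) ∈ C := by
      refine hC _ ha _ (φ.map_adj_iff.2 (coneGraph_adj_none_some.2 ?_)) fun w hw => ?_
      · rw [M_ports]; simp
      · by_cases hwr : w ∈ Set.range φ
        · obtain ⟨_ | k, rfl⟩ := hwr
          · exact absurd hw (G.irrefl)
          · have := coneGraph_adj_none_some.1 (φ.map_adj_iff.1 hw)
            rw [M_ports] at this
            rcases this with rfl | rfl | rfl
            exacts [Or.inl hb, Or.inl hc, Or.inr rfl]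
        · have := (hnb _ w hwr hw).1
          simp at this
    have := hC.blockM (φ.comp (coneSome (M n))) ?_ ?_
    · rintro _ ⟨_ | k, rfl⟩
      exacts [ha, this ⟨k, rfl⟩]
    · rw [M_ports]
      rintro _ ⟨k, rfl | rfl | rfl, rfl⟩
      exacts [hb, hc, hd]
    · intro k hk w hw
      by_cases hwr : w ∈ Set.range φ
      · obtain ⟨_ | k, rfl⟩ := hwr
        exacts [Or.inl ha, Or.inr ⟨k, rfl⟩]
      · obtain ⟨k', hk', he⟩ := (hnb _ w hwr hw).1
        exact absurd (Option.some_injective _ he ▸ hk') hk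
  | @step H hH n f ih =>
    obtain ⟨a, b, c, habc⟩ := ih
    refine ⟨Sum.inl a, Sum.inl b, Sum.inl c, ?_⟩
    intro φ hnb C hC ha hb hc
    have hin : ∀ h w, G.Adj (φ (Sum.inl h)) w → w ∈ Set.range φ := by
      intro h w hw
      by_contra hwr
      obtain ⟨k, -, hk⟩ := (hnb _ w hwr hw).1
      cases hk
    have hleft : Set.range (φ.comp (compoundInl H (M n) f)) ⊆ C := by
      refine habc _ (fun h w hwr hw => ?_) C hC ha hb hc
      obtain ⟨hh, rfl⟩ := compound_inl_outside φ hin h w hwr hw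
      refine ⟨hh, fun w' hwr' hw' => ?_⟩
      obtain ⟨-, rfl⟩ := compound_inl_outside φ hin h w' hwr' hw'
      rfl
    have hright := hC.blockM _ (hC.compound_ports φ hleft hin) ?_
    · rintro _ ⟨k | k, rfl⟩
      exacts [hleft ⟨k, rfl⟩, hright ⟨k, rfl⟩]
    · intro k hk w hw
      by_cases hwr : w ∈ Set.range φ
      · obtain ⟨k | k, rfl⟩ := hwr
        exacts [Or.inl (hleft ⟨k, rfl⟩), Or.inr ⟨k, rfl⟩]
      · obtain ⟨k', hk', he⟩ := (hnb _ w hwr hw).1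
        exact absurd (Sum.inr_injective he ▸ hk') hk

theorem InFamily.exists_forcing_triple (h : InFamily G) :
    ∃ a b c : V, Progresses G {a, b, c} := by
  rcases h with ⟨m, ⟨e⟩⟩ | ⟨H, hH, m, f, ⟨e⟩⟩
  · let φ := e.symm.toEmbedding
    have hφ : ∀ w, w ∈ Set.range φ := e.symm.surjective
    refine ⟨φ none, φ (some (Sum.inl (0, true))), φ (some (Sum.inl (0, false))),
      progresses_of_forceClosed fun C hS hC => ?_⟩
    have ha : φ none ∈ C := hS (by simp)
    have hb : φ (some (Sum.inl (0, true))) ∈ C := hS (by simp)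
    have hc : φ (some (Sum.inl (0, false))) ∈ C := hS (by simp)
    have hd : φ (some (Sum.inr ())) ∈ C := by
      refine hC _ ha _ (φ.map_adj_iff.2 (coneGraph_adj_none_some.2 ?_)) fun w hw => ?_
      · rw [T_ports]; simp
      · obtain ⟨_ | k, rfl⟩ := hφ w
        · exact absurd hw (G.irrefl)
        · have := coneGraph_adj_none_some.1 (φ.map_adj_iff.1 hw)
          rw [T_ports] at this
          rcases this with rfl | rfl | rfl
          exacts [Or.inl hb, Or.inl hc, Or.inr rfl]
    have := hC.blockT (φ.comp (coneSome (T m))) ?_ ?_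
    · refine Set.eq_univ_of_forall fun w => ?_
      obtain ⟨_ | k, rfl⟩ := hφ w
      exacts [ha, this ⟨k, rfl⟩]
    · rw [T_ports]
      rintro _ ⟨k, rfl | rfl | rfl, rfl⟩
      exacts [hb, hc, hd]
    · intro k w hw
      obtain ⟨_ | k, rfl⟩ := hφ w
      exacts [Or.inl ha, Or.inr ⟨k, rfl⟩]
  · let φ := e.symm.toEmbedding
    have hφ : ∀ w, w ∈ Set.range φ := e.symm.surjective
    obtain ⟨a, b, c, habc⟩ := hH.exists_forcing_triple (G := G)
    refine ⟨φ (Sum.inl a), φ (Sum.inl b), φ (Sum.inl c),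
      progresses_of_forceClosed fun C hS hC => ?_⟩
    have hin : ∀ h w, G.Adj (φ (Sum.inl h)) w → w ∈ Set.range φ := fun _ w _ => hφ w
    have hleft : Set.range (φ.comp (compoundInl H (T m) f)) ⊆ C := by
      refine habc _ (fun h w hwr hw => ?_) C hC (hS (by simp [φ, compoundInl]))
        (hS (by simp [φ, compoundInl])) (hS (by simp [φ, compoundInl]))
      obtain ⟨hh, rfl⟩ := compound_inl_outside φ hin h w hwr hw
      refine ⟨hh, fun w' hwr' hw' => ?_⟩
      obtain ⟨-, rfl⟩ := compound_inl_outside φ hin h w' hwr' hw'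
      rfl
    have hright := hC.blockT _ (hC.compound_ports φ hleft hin) fun k w _ => by
      obtain ⟨k | k, rfl⟩ := hφ w
      exacts [Or.inl (hleft ⟨k, rfl⟩), Or.inr ⟨k, rfl⟩]
    refine Set.eq_univ_of_forall fun w => ?_
    obtain ⟨k | k, rfl⟩ := hφ w
    exacts [hleft ⟨k, rfl⟩, hright ⟨k, rfl⟩]

end FamilyForcing

/-! ### The front of three outside neighbors and how it advances. -/

section Front

variable {V : Type*} {G : SimpleGraph V} {S D : Set V} {x y z : V}

/-- `x`, `y`, `z` are the outside neighbors of `D`, each with exactly one neighbor in `D`, and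
`S` is contained in `D ∪ {x, y, z}`. -/
structure Front (G : SimpleGraph V) (S D : Set V) (x y z : V) : Prop where
  sub : S ⊆ D ∪ {x, y, z}
  nx : x ∉ D
  ny : y ∉ D
  nz : z ∉ D
  xy : x ≠ y
  xz : x ≠ z
  yz : y ≠ z
  out : ∀ u ∈ D, ∀ w, w ∉ D → G.Adj u w → w = x ∨ w = y ∨ w = z
  ox : ∃ a ∈ D, ∀ w ∈ D, G.Adj x w ↔ w = a
  oy : ∃ a ∈ D, ∀ w ∈ D, G.Adj y w ↔ w = a
  oz : ∃ a ∈ D, ∀ w ∈ D, G.Adj z w ↔ w = a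

theorem Front.swap (h : Front G S D x y z) : Front G S D y x z where
  sub := by rw [Set.insert_comm]; exact h.sub
  nx := h.ny
  ny := h.nx
  nz := h.nz
  xy := h.xy.symm
  xz := h.yz
  yz := h.xz
  out u hu w hw ha := by have := h.out u hu w hw ha; tauto
  ox := h.oy
  oy := h.ox
  oz := h.oz

theorem Front.rotate (h : Front G S D x y z) : Front G S D y z x where
  sub := by rw [Set.pair_comm, Set.insert_comm]; exact h.sub
  nx := h.ny
  ny := h.nz
  nz := h.nx
  xy := h.yz
  xz := h.xy.symm
  yz := h.xz.symm
  out u hu w hw ha := by have := h.out u hu w hw ha; tauto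
  ox := h.oy
  oy := h.oz
  oz := h.ox

/-- All neighbors of `x` lie in `D ∪ {x, y, z}`, whose boundary is thus within `{y, z}`. So this set
is everything, yet the third neighbor of `y` is not in it. -/
theorem Front.not_two_adj [Finite V] (h : Front G S D x y z) (hG : IsCubic G)
    (hS : Progresses G S) (hxy : G.Adj x y) (hxz : G.Adj x z) (hyz : ¬ G.Adj y z) : False := by
  obtain ⟨a, ha, hxa⟩ := h.ox
  obtain ⟨b, hb, hyb⟩ := h.oy
  have huniv := hS.eq_univ_of_boundary hG _ h.sub y z (by
    intro u hu w hw huw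
    simp only [Set.mem_union, Set.mem_insert_iff, Set.mem_singleton_iff, not_or] at hu hw
    rcases hu with hu | rfl | rfl | rfl
    · have := h.out u hu w hw.1 huw
      tauto
    · have := hG.eq_of_adj ((hxa a ha).2 rfl) hxy hxz (fun e => h.ny (e ▸ ha))
        (fun e => h.nz (e ▸ ha)) h.yz huw
      rcases this with rfl | rfl | rfl
      · exact absurd ha hw.1
      · exact absurd rfl hw.2.2.1
      · exact absurd rfl hw.2.2.2
    · exact Or.inl rfl
    · exact Or.inr rfl)
  obtain ⟨w, hw, hwb, hwx⟩ := hG.exists_ne y b x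
  have hm : w ∈ D ∪ {x, y, z} := huniv ▸ Set.mem_univ w
  rcases hm with hm | rfl | rfl | rfl
  · exact hwb ((hyb w hm).1 hw)
  · exact hwx rfl
  · exact G.irrefl hw
  · exact hyz hw

theorem Front.not_isolated [Finite V] (h : Front G S D x y z) (hG : IsCubic G)
    (hxy : ¬ G.Adj x y) (hxz : ¬ G.Adj x z) (v : V) :
    ∃ w, G.Adj x w ∧ w ∉ D ∪ {x, y, z} ∧ w ≠ v := by
  obtain ⟨a, ha, hxa⟩ := h.ox
  obtain ⟨w, hw, hwa, hwv⟩ := hG.exists_ne x a v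
  refine ⟨w, hw, ?_, hwv⟩
  rintro (hm | rfl | rfl | rfl)
  · exact hwa ((hxa w hm).1 hw)
  · exact G.irrefl hw
  · exact hxy hw
  · exact hxz hw

/-- Each of `x`, `y`, `z` has two neighbors outside `D ∪ {x, y, z}` and the vertices of `D` have
none, so no force is possible. -/
theorem Front.not_none_adj [Finite V] (h : Front G S D x y z) (hG : IsCubic G)
    (hS : Progresses G S) (hxy : ¬ G.Adj x y) (hxz : ¬ G.Adj x z) (hyz : ¬ G.Adj y z) : False := by
  have hx := h.not_isolated hG hxy hxz
  have hy := h.swap.not_isolated hG (fun e => hxy e.symm) hyz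
  have hz := h.rotate.rotate.not_isolated hG (fun e => hxz e.symm) (fun e => hyz e.symm)
  have e1 : D ∪ {y, x, z} = D ∪ {x, y, z} := by rw [Set.insert_comm]
  have e2 : D ∪ {z, x, y} = D ∪ {x, y, z} := by rw [Set.insert_comm, Set.pair_comm]
  rw [e1] at hy
  rw [e2] at hz
  obtain ⟨w, -, hw, -⟩ := hx x
  obtain ⟨u, hu, v, hv, huv, hall⟩ := hS _ h.sub fun e => hw (e ▸ Set.mem_univ w)
  have hcon : (∃ w, G.Adj u w ∧ w ∉ D ∪ {x, y, z} ∧ w ≠ v) → False := by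
    rintro ⟨w, hw1, hw2, hw3⟩
    exact (hall w hw1).elim hw2 hw3
  rcases hu with hu | rfl | rfl | rfl
  · have := h.out u hu v (fun e => hv (Or.inl e)) huv
    exact hv (Or.inr this)
  · exact hcon (hx v)
  · exact hcon (hy v)
  · exact hcon (hz v)

theorem Front.eq_univ [Finite V] (h : Front G S D x y z) (hG : IsCubic G)
    (hS : Progresses G S) (hxy : G.Adj x y) (hxz : G.Adj x z) (hyz : G.Adj y z) :
    D ∪ {x, y, z} = Set.univ := by
  have key : ∀ {x y z u w : V}, Front G S D x y z → G.Adj x y → G.Adj x z → u = x → G.Adj u w →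
      w ∈ D ∪ {x, y, z} := by
    rintro x y z u w h hxy hxz rfl huw
    obtain ⟨a, ha, hxa⟩ := h.ox
    have := hG.eq_of_adj ((hxa a ha).2 rfl) hxy hxz (fun e => h.ny (e ▸ ha))
      (fun e => h.nz (e ▸ ha)) h.yz huw
    rcases this with rfl | rfl | rfl
    · exact Or.inl ha
    · simp
    · simp
  have e1 : D ∪ {y, x, z} = D ∪ {x, y, z} := by rw [Set.insert_comm]
  have e2 : D ∪ {z, x, y} = D ∪ {x, y, z} := by rw [Set.insert_comm, Set.pair_comm]
  refine hS.eq_univ_of_boundary hG _ h.sub x x ?_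
  intro u hu w hw huw
  exfalso
  rcases hu with hu | hu | hu | hu
  · exact hw (Or.inr (h.out u hu w (fun e => hw (Or.inl e)) huw))
  · exact hw (key h hxy hxz hu huw)
  · exact hw (e1 ▸ key h.swap hxy.symm hyz hu huw)
  · exact hw (e2 ▸ key h.rotate.rotate hxz.symm hyz.symm hu huw)

theorem Front.adj_cases [Finite V] (h : Front G S D x y z) (hG : IsCubic G)
    (hS : Progresses G S) :
    (G.Adj x y ∧ G.Adj x z ∧ G.Adj y z ∧ D ∪ {x, y, z} = Set.univ) ∨
      (G.Adj x y ∧ ¬ G.Adj x z ∧ ¬ G.Adj y z) ∨ (¬ G.Adj x y ∧ G.Adj x z ∧ ¬ G.Adj y z) ∨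
      (¬ G.Adj x y ∧ ¬ G.Adj x z ∧ G.Adj y z) := by
  by_cases hxy : G.Adj x y <;> by_cases hxz : G.Adj x z <;> by_cases hyz : G.Adj y z
  · exact Or.inl ⟨hxy, hxz, hyz, h.eq_univ hG hS hxy hxz hyz⟩
  · exact (h.not_two_adj hG hS hxy hxz hyz).elim
  · exact (h.swap.not_two_adj hG hS hxy.symm hyz hxz).elim
  · tauto
  · exact (h.rotate.rotate.not_two_adj hG hS hxz.symm hyz.symm hxy).elim
  · tauto
  · tauto
  · exact (h.not_none_adj hG hS hxy hxz hyz).elim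

theorem Front.exists_outside (h : Front G S D x y z) (hG : IsCubic G) (hxy : G.Adj x y)
    (hxz : ¬ G.Adj x z) :
    ∃ x', x' ∉ D ∪ {x, y} ∧ x' ≠ z ∧ ∀ w, w ∉ D ∪ {x, y} → (G.Adj x w ↔ w = x') := by
  obtain ⟨a, ha, hxa⟩ := h.ox
  obtain ⟨x', hx', hxa', hxy', hall⟩ :=
    hG.exists_third ((hxa a ha).2 rfl) hxy (fun e => h.ny (e ▸ ha))
  refine ⟨x', ?_, fun e => hxz (e ▸ hx'), ?_⟩
  · rintro (hm | rfl | rfl)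
    · exact hxa' ((hxa x' hm).1 hx')
    · exact G.irrefl hx'
    · exact hxy' rfl
  · intro w hw
    refine ⟨fun hxw => ?_, fun e => e ▸ hx'⟩
    rcases hall w hxw with rfl | rfl | rfl
    · exact absurd (Or.inl ha) hw
    · exact absurd (by simp) hw
    · rfl

/-- Besides a neighbor in `D` and each other, `x` and `y` have one further neighbor each; these
replace them in the front while `z` waits. -/
theorem Front.advance [Finite V] (h : Front G S D x y z) (hG : IsCubic G)
    (hS : Progresses G S) (hxy : G.Adj x y) (hxz : ¬ G.Adj x z) (hyz : ¬ G.Adj y z) :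
    ∃ x' y', Front G S (D ∪ {x, y}) x' y' z ∧
      (∀ w, w ∉ D ∪ {x, y} → (G.Adj x w ↔ w = x')) ∧
      (∀ w, w ∉ D ∪ {x, y} → (G.Adj y w ↔ w = y')) := by
  obtain ⟨x', hx', hxz', hxall⟩ := h.exists_outside hG hxy hxz
  obtain ⟨y', hy', hyz', hyall⟩ := h.swap.exists_outside hG hxy.symm hyz
  rw [Set.pair_comm] at hy' hyall
  obtain ⟨c, hc, hzc⟩ := h.oz
  have hz : z ∉ D ∪ {x, y} := by
    rintro (hm | rfl | rfl)
    exacts [h.nz hm, h.xz rfl, h.yz rfl]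
  have hD : ∀ u ∈ D, ∀ w, w ∉ D ∪ {x, y} → G.Adj u w → w = z := by
    intro u hu w hw huw
    rcases h.out u hu w (fun e => hw (Or.inl e)) huw with rfl | rfl | rfl
    · exact absurd (by simp) hw
    · exact absurd (by simp) hw
    · rfl
  have hzD : ∀ w ∈ D ∪ {x, y}, G.Adj z w ↔ w = c := by
    intro w hw
    rcases hw with hw | rfl | rfl
    · exact hzc w hw
    · exact iff_of_false (fun e => hxz e.symm) (fun e => h.nx (e ▸ hc))
    · exact iff_of_false (fun e => hyz e.symm) (fun e => h.ny (e ▸ hc))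
  -- A common outside neighbor `x'` would give `D ∪ {x, y, z, x'}` a boundary within `{x', z}`. It
  -- would then be everything, leaving `z` with no neighbors but `c` and `x'`.
  have hxy' : x' ≠ y' := by
    rintro rfl
    have huniv := hS.eq_univ_of_boundary hG (insert x' (insert z (D ∪ {x, y}))) (fun w hw => by
      rcases h.sub hw with hm | hm | hm | hm
      · exact Or.inr (Or.inr (Or.inl hm))
      · exact Or.inr (Or.inr (Or.inr (Or.inl hm)))
      · exact Or.inr (Or.inr (Or.inr (Or.inr hm)))
      · exact Or.inr (Or.inl hm)) x' z (by
      intro u hu w hw huw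
      simp only [Set.mem_insert_iff, not_or] at hu hw
      obtain ⟨hw1, hw2, hw3⟩ := hw
      rcases hu with hu | hu | hu | rfl | rfl
      · exact Or.inl hu
      · exact Or.inr hu
      · exact absurd (hD u hu w hw3 huw) hw2
      · exact absurd ((hxall w hw3).1 huw) hw1
      · exact absurd ((hyall w hw3).1 huw) hw1)
    obtain ⟨w, hw, hwc, hwx⟩ := hG.exists_ne z c x'
    have hm : w ∈ insert x' (insert z (D ∪ {x, y})) := huniv ▸ Set.mem_univ w
    rcases hm with rfl | rfl | hm
    · exact hwx rfl
    · exact G.irrefl hw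
    · exact hwc ((hzD w hm).1 hw)
  refine ⟨x', y', ⟨?_, hx', hy', hz, hxy', hxz', hyz', ?_, ?_, ?_, ?_⟩, hxall, hyall⟩
  · intro w hw
    rcases h.sub hw with hm | hm | hm | hm
    · exact Or.inl (Or.inl hm)
    · exact Or.inl (Or.inr (Or.inl hm))
    · exact Or.inl (Or.inr (Or.inr hm))
    · exact Or.inr (Or.inr (Or.inr hm))
  · intro u hu w hw huw
    rcases hu with hu | rfl | rfl
    · exact Or.inr (Or.inr (hD u hu w hw huw))
    · exact Or.inl ((hxall w hw).1 huw)
    · exact Or.inr (Or.inl ((hyall w hw).1 huw))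
  · refine ⟨x, by simp, ?_⟩
    rintro w (hw | rfl | rfl)
    · exact iff_of_false (fun e => hxz' (hD w hw x' hx' e.symm)) (fun e => h.nx (e ▸ hw))
    · exact iff_of_true ((hxall x' hx').2 rfl).symm rfl
    · exact iff_of_false (fun e => hxy' ((hyall x' hx').1 e.symm)) h.xy.symm
  · refine ⟨y, by simp, ?_⟩
    rintro w (hw | rfl | rfl)
    · exact iff_of_false (fun e => hyz' (hD w hw y' hy' e.symm)) (fun e => h.ny (e ▸ hw))
    · exact iff_of_false (fun e => hxy' ((hxall y' hy').1 e.symm).symm) h.xy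
    · exact iff_of_true ((hyall y' hy').2 rfl).symm rfl
  · exact ⟨c, Or.inl hc, hzD⟩

end Front

/-! ### Ladders inside a graph, indexed by `ℕ` so that adding a rung keeps the type. -/

section Ladder

variable {V : Type*} {G : SimpleGraph V}

/-- The vertices `l i s` with `i ≤ n` induce a ladder. -/
structure IsLadder (G : SimpleGraph V) (n : ℕ) (l : ℕ → Bool → V) : Prop where
  inj : ∀ i ≤ n, ∀ j ≤ n, ∀ s t, l i s = l j t → i = j ∧ s = t
  adj : ∀ i ≤ n, ∀ j ≤ n, ∀ s t,
    G.Adj (l i s) (l j t) ↔ (i = j ∧ s ≠ t) ∨ (i + 1 = j ∧ s = t) ∨ (j + 1 = i ∧ s = t)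

/-- The vertices `l i s` with `i ≤ n`. -/
def ladderSet (n : ℕ) (l : ℕ → Bool → V) : Set V := {w | ∃ i ≤ n, ∃ s, w = l i s}

/-- The ladder `l` with the rung `t` put at position `n + 1`. -/
def ladderExtend (n : ℕ) (l : ℕ → Bool → V) (t : Bool → V) : ℕ → Bool → V :=
  fun i s => if i = n + 1 then t s else l i s

theorem ladderExtend_of_le {n i : ℕ} (l : ℕ → Bool → V) (t : Bool → V) (h : i ≤ n) (s : Bool) :
    ladderExtend n l t i s = l i s :=
  if_neg (by omega)

theorem ladderExtend_succ (n : ℕ) (l : ℕ → Bool → V) (t : Bool → V) (s : Bool) :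
    ladderExtend n l t (n + 1) s = t s :=
  if_pos rfl

theorem ladderSet_extend (n : ℕ) (l : ℕ → Bool → V) (t : Bool → V) :
    ladderSet (n + 1) (ladderExtend n l t) = ladderSet n l ∪ {t true, t false} := by
  ext w
  constructor
  · rintro ⟨i, hi, s, rfl⟩
    rcases hi.lt_or_eq with hi | rfl
    · rw [ladderExtend_of_le l t (by omega)]
      exact Or.inl ⟨i, by omega, s, rfl⟩
    · rw [ladderExtend_succ]
      cases s <;> simp
  · rintro (⟨i, hi, s, rfl⟩ | rfl | rfl)
    · exact ⟨i, by omega, s, (ladderExtend_of_le l t hi s).symm⟩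
    · exact ⟨n + 1, le_rfl, true, (ladderExtend_succ n l t true).symm⟩
    · exact ⟨n + 1, le_rfl, false, (ladderExtend_succ n l t false).symm⟩

theorem ladderSet_not (n : ℕ) (l : ℕ → Bool → V) :
    ladderSet n (fun i s => l i !s) = ladderSet n l := by
  ext w
  constructor
  · rintro ⟨i, hi, s, rfl⟩
    exact ⟨i, hi, !s, rfl⟩
  · rintro ⟨i, hi, s, rfl⟩
    exact ⟨i, hi, !s, by simp⟩

theorem IsLadder.not {n : ℕ} {l : ℕ → Bool → V} (h : IsLadder G n l) :
    IsLadder G n (fun i s => l i !s) where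
  inj i hi j hj s t e := by
    obtain ⟨h1, h2⟩ := h.inj i hi j hj _ _ e
    exact ⟨h1, by simpa using h2⟩
  adj i hi j hj s t := by
    rw [h.adj i hi j hj]
    simp

theorem IsLadder.extend {n : ℕ} {l : ℕ → Bool → V} {t : Bool → V} (h : IsLadder G n l)
    (ht : ∀ s, t s ∉ ladderSet n l) (hne : t true ≠ t false) (hadj : G.Adj (t true) (t false))
    (hlt : ∀ i ≤ n, ∀ r s, G.Adj (l i r) (t s) ↔ i = n ∧ r = s) :
    IsLadder G (n + 1) (ladderExtend n l t) where
  inj i hi j hj r s e := by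
    rcases hi.lt_or_eq with hi | rfl <;> rcases hj.lt_or_eq with hj | rfl
    · rw [ladderExtend_of_le l t (by omega), ladderExtend_of_le l t (by omega)] at e
      exact h.inj i (by omega) j (by omega) r s e
    · rw [ladderExtend_of_le l t (by omega), ladderExtend_succ] at e
      exact absurd ⟨i, by omega, r, e.symm⟩ (ht s)
    · rw [ladderExtend_succ, ladderExtend_of_le l t (by omega)] at e
      exact absurd ⟨j, by omega, s, e⟩ (ht r)
    · rw [ladderExtend_succ, ladderExtend_succ] at e
      refine ⟨rfl, ?_⟩
      cases r <;> cases s <;> first | rfl | exact absurd e hne | exact absurd e.symm hne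
  adj i hi j hj r s := by
    rcases hi.lt_or_eq with hi | rfl <;> rcases hj.lt_or_eq with hj | rfl
    · rw [ladderExtend_of_le l t (by omega), ladderExtend_of_le l t (by omega)]
      exact h.adj i (by omega) j (by omega) r s
    · rw [ladderExtend_of_le l t (by omega), ladderExtend_succ, hlt i (by omega)]
      have h1 : i ≠ n + 1 := by omega
      have h2 : n + 1 + 1 ≠ i := by omega
      simp [h1, h2]
    · rw [ladderExtend_succ, ladderExtend_of_le l t (by omega), G.adj_comm, hlt j (by omega)]
      have h1 : n + 1 ≠ j := by omega
      have h2 : n + 1 + 1 ≠ j := by omega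
      simp [h1, h2, eq_comm]
    · rw [ladderExtend_succ, ladderExtend_succ]
      cases r <;> cases s <;> simp [hadj, hadj.symm]

theorem isLadder_zero {x y : V} (h : G.Adj x y) :
    IsLadder G 0 (fun _ s => cond s x y) where
  inj i hi j hj s t e := by
    have hne := h.ne
    obtain rfl : i = 0 := by omega
    obtain rfl : j = 0 := by omega
    cases s <;> cases t <;> simp_all [eq_comm]
  adj i hi j hj s t := by
    obtain rfl : i = 0 := by omega
    obtain rfl : j = 0 := by omega
    cases s <;> cases t <;> simp [h, h.symm]

theorem ladderSet_zero (x y : V) : ladderSet 0 (fun _ s => cond s x y) = {x, y} := by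
  ext w
  simp [ladderSet, or_comm]

theorem range_ladder {n : ℕ} (l : ℕ → Bool → V) :
    Set.range (fun a : Fin (n + 1) × Bool => l a.1 a.2) = ladderSet n l := by
  ext w
  constructor
  · rintro ⟨⟨i, s⟩, rfl⟩
    exact ⟨i, by omega, s, rfl⟩
  · rintro ⟨i, hi, s, rfl⟩
    exact ⟨(⟨i, by omega⟩, s), rfl⟩

theorem IsLadder.injective {n : ℕ} {l : ℕ → Bool → V} (h : IsLadder G n l) :
    Function.Injective fun a : Fin (n + 1) × Bool => l a.1 a.2 := by
  rintro ⟨⟨i, hi⟩, s⟩ ⟨⟨j, hj⟩, t⟩ e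
  obtain ⟨h1, h2⟩ := h.inj i (by omega) j (by omega) s t e
  subst h1 h2
  rfl

theorem IsLadder.ladder_adj {n : ℕ} {l : ℕ → Bool → V} (h : IsLadder G n l)
    (a b : Fin (n + 1) × Bool) : G.Adj (l a.1 a.2) (l b.1 b.2) ↔ (ladder n).Adj a b := by
  rw [CubicZF.ladder_adj, h.adj _ (by omega) _ (by omega)]

theorem IsLadder.exists_embedding_T {n : ℕ} {l : ℕ → Bool → V} {z : V} (h : IsLadder G n l)
    (hz : z ∉ ladderSet n l) (hadj : ∀ i ≤ n, ∀ s, G.Adj (l i s) z ↔ i = n) :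
    ∃ ψ : (T n).graph ↪g G, Set.range ψ = ladderSet n l ∪ {z} ∧
      ψ '' (T n).ports = {l 0 true, l 0 false, z} := by
  have hadj' : ∀ a : Fin (n + 1) × Bool, G.Adj (l a.1 a.2) z ↔ a.1 = Fin.last n := by
    intro a
    rw [hadj _ (by omega), Fin.ext_iff, Fin.val_last]
  refine ⟨⟨⟨Sum.elim (fun a => l a.1 a.2) (fun _ => z), ?_⟩, ?_⟩, ?_, ?_⟩
  · refine Function.Injective.sumElim h.injective (fun _ _ _ => rfl) fun a _ e => hz ?_
    exact ⟨a.1, by omega, a.2, e.symm⟩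
  · rintro (a | a) (b | b)
    · exact (h.ladder_adj a b).trans graphT_adj_inl_inl.symm
    · exact (hadj' a).trans graphT_adj_inl_inr.symm
    · exact ((G.adj_comm _ _).trans (hadj' b)).trans graphT_adj_inr_inl.symm
    · exact iff_of_false G.irrefl not_graphT_adj_inr_inr
  · refine (Set.Sum.elim_range _ _).trans ?_
    rw [range_ladder, Set.range_const]
  · rw [T_ports, Set.image_insert_eq, Set.image_pair]
    rfl

theorem IsLadder.exists_embedding_M {n : ℕ} {l : ℕ → Bool → V} {c d : V} (h : IsLadder G n l)
    (hc : c ∉ ladderSet n l) (hd : d ∉ ladderSet n l) (hcd : G.Adj c d)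
    (hadjc : ∀ i ≤ n, ∀ s, G.Adj (l i s) c ↔ i = n ∧ s = false)
    (hadjd : ∀ i ≤ n, ∀ s, ¬ G.Adj (l i s) d) :
    ∃ ψ : (M n).graph ↪g G, Set.range ψ = ladderSet n l ∪ {c, d} ∧
      ψ '' (M n).ports = {l 0 true, l 0 false, d} ∧ ψ '' (M n).white = {l n true, c, d} := by
  have hadj' : ∀ (a : Fin (n + 1) × Bool) (t : Bool),
      G.Adj (l a.1 a.2) (cond t d c) ↔ a = (Fin.last n, false) ∧ t = false := by
    rintro ⟨i, s⟩ t
    cases t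
    · simp only [cond_false, hadjc _ (show (i : ℕ) ≤ n by omega), Prod.mk.injEq, Fin.ext_iff,
        Fin.val_last, and_true]
    · simp [hadjd _ (show (i : ℕ) ≤ n by omega)]
  refine ⟨⟨⟨Sum.elim (fun a => l a.1 a.2) (fun t => cond t d c), ?_⟩, ?_⟩, ?_, ?_, ?_⟩
  · refine Function.Injective.sumElim h.injective ?_ fun a t e => ?_
    · intro s t e
      have hne := hcd.ne
      cases s <;> cases t <;> simp_all [eq_comm]
    · cases t
      · exact hc ⟨a.1, by omega, a.2, e.symm⟩
      · exact hd ⟨a.1, by omega, a.2, e.symm⟩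
  · rintro (a | s) (b | t)
    · exact (h.ladder_adj a b).trans graphM_adj_inl_inl.symm
    · exact (hadj' a t).trans graphM_adj_inl_inr.symm
    · exact ((G.adj_comm _ _).trans (hadj' b s)).trans graphM_adj_inr_inl.symm
    · refine Iff.trans ?_ graphM_adj_inr_inr.symm
      change G.Adj (cond s d c) (cond t d c) ↔ _
      cases s <;> cases t <;> simp [hcd, hcd.symm]
  · refine (Set.Sum.elim_range _ _).trans ?_
    rw [range_ladder]
    congr 1
    ext w
    simp [eq_comm]
  · rw [M_ports, Set.image_insert_eq, Set.image_pair]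
    rfl
  · rw [Set.image_insert_eq, Set.image_pair]
    rfl

end Ladder

/-! ### Reading off the blocks, and the classification. -/

section Structure

variable {V : Type*} {G : SimpleGraph V} {S B : Set V}

/-- A ladder `l` with `n` squares is attached to the prefix on `B`; its last rung has the outside
neighbors `t`, and the remaining outside neighbor `z` of `B` is not adjacent to the ladder. -/
structure LadderStage (G : SimpleGraph V) (S B : Set V) (n : ℕ) (l : ℕ → Bool → V)
    (t : Bool → V) (z : V) : Prop where
  ext : Extends G B {l 0 true, l 0 false, z}
  disj : Disjoint B (ladderSet n l)
  ladder : IsLadder G n l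
  not_adj : ∀ i ≤ n, ∀ s, ¬ G.Adj (l i s) z
  front : Front G S (B ∪ ladderSet n l) (t true) (t false) z
  out : ∀ i ≤ n, ∀ s w, w ∉ B ∪ ladderSet n l → (G.Adj (l i s) w ↔ i = n ∧ w = t s)

namespace LadderStage

variable {n : ℕ} {l : ℕ → Bool → V} {t : Bool → V} {z : V}

theorem not (h : LadderStage G S B n l t z) :
    LadderStage G S B n (fun i s => l i !s) (fun s => t !s) z where
  ext := by
    have := h.ext
    rw [Set.insert_comm] at this
    exact this
  disj := by rw [ladderSet_not]; exact h.disj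
  ladder := h.ladder.not
  not_adj i hi s := h.not_adj i hi _
  front := by rw [ladderSet_not]; exact h.front.swap
  out i hi s w hw := by
    rw [ladderSet_not] at hw
    exact h.out i hi _ w hw

theorem notMem (h : LadderStage G S B n l t z) (s : Bool) : t s ∉ B ∪ ladderSet n l := by
  cases s
  exacts [h.front.ny, h.front.nx]

theorem adj_rung (h : LadderStage G S B n l t z) (i : ℕ) (hi : i ≤ n) (r s : Bool) :
    G.Adj (l i r) (t s) ↔ i = n ∧ r = s := by
  rw [h.out i hi r _ (h.notMem s)]
  have := h.front.xy
  cases r <;> cases s <;> simp [this, this.symm]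

/-- The unique neighbor of `t s` behind the front is already `l n s`, on the ladder. -/
theorem not_adj_prefix (h : LadderStage G S B n l t z) {b : V} (hb : b ∈ B) (s : Bool) :
    ¬ G.Adj b (t s) := by
  intro hadj
  obtain ⟨a, -, ha⟩ : ∃ a ∈ B ∪ ladderSet n l, ∀ w ∈ B ∪ ladderSet n l,
      G.Adj (t s) w ↔ w = a := by
    cases s
    exacts [h.front.oy, h.front.ox]
  have hl : l n s ∈ ladderSet n l := ⟨n, le_rfl, s, rfl⟩
  have h1 := (ha b (Or.inl hb)).1 hadj.symm
  have h2 := (ha (l n s) (Or.inr hl)).1 ((h.adj_rung n le_rfl s s).2 ⟨rfl, rfl⟩).symm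
  rw [← h2] at h1
  exact Set.disjoint_left.1 h.disj hb (h1 ▸ hl)

theorem isLadder_extend (h : LadderStage G S B n l t z) (hadj : G.Adj (t true) (t false)) :
    IsLadder G (n + 1) (ladderExtend n l t) :=
  h.ladder.extend (fun s e => h.notMem s (Or.inr e)) h.front.xy hadj h.adj_rung

theorem disjoint_extend (h : LadderStage G S B n l t z) :
    Disjoint B (ladderSet (n + 1) (ladderExtend n l t)) := by
  rw [ladderSet_extend, Set.disjoint_union_right]
  refine ⟨h.disj, Set.disjoint_left.2 ?_⟩
  rintro b hb (rfl | rfl)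
  exacts [h.notMem true (Or.inl hb), h.notMem false (Or.inl hb)]

/-- The vertices `t` form a further rung and `z` is the top of the triangle, so the last block is `T
(n + 1)`. -/
theorem inFamily (h : LadderStage G S B n l t z) (h1 : G.Adj (t true) (t false))
    (h2 : G.Adj (t true) z) (h3 : G.Adj (t false) z)
    (huniv : B ∪ ladderSet n l ∪ {t true, t false, z} = Set.univ) : InFamily G := by
  have hz : z ∉ ladderSet (n + 1) (ladderExtend n l t) := by
    rw [ladderSet_extend]
    rintro (e | e | e)
    exacts [h.front.nz (Or.inr e), h.front.xz e.symm, h.front.yz e.symm]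
  have hadj : ∀ i ≤ n + 1, ∀ s, G.Adj (ladderExtend n l t i s) z ↔ i = n + 1 := by
    intro i hi s
    rcases hi.lt_or_eq with hi | rfl
    · rw [ladderExtend_of_le l t (by omega)]
      exact iff_of_false (h.not_adj i (by omega) s) (by omega)
    · rw [ladderExtend_succ]
      cases s
      exacts [iff_of_true h3 rfl, iff_of_true h2 rfl]
  obtain ⟨ψ, hr, hp⟩ := (h.isLadder_extend h1).exists_embedding_T (z := z) hz hadj
  refine h.ext.inFamily ψ ?_ ?_ ?_
  · rw [hr, Set.disjoint_union_right, Set.disjoint_singleton_right]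
    exact ⟨h.disjoint_extend, fun e => h.front.nz (Or.inl e)⟩
  · rw [hp, ladderExtend_of_le l t (Nat.zero_le n), ladderExtend_of_le l t (Nat.zero_le n)]
  · rw [hr, ladderSet_extend, ← huniv, Set.union_assoc, Set.union_assoc,
      Set.insert_union, Set.singleton_union]

theorem extend [Finite V] (h : LadderStage G S B n l t z) (hG : IsCubic G)
    (hS : Progresses G S) (h1 : G.Adj (t true) (t false)) (h2 : ¬ G.Adj (t true) z)
    (h3 : ¬ G.Adj (t false) z) :
    ∃ t', LadderStage G S B (n + 1) (ladderExtend n l t) t' z := by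
  obtain ⟨x', y', hf, hx, hy⟩ := h.front.advance hG hS h1 h2 h3
  have hset : B ∪ ladderSet (n + 1) (ladderExtend n l t) =
      B ∪ ladderSet n l ∪ {t true, t false} := by
    rw [ladderSet_extend, Set.union_assoc]
  refine ⟨fun s => cond s x' y', ⟨?_, h.disjoint_extend, h.isLadder_extend h1, ?_, ?_, ?_⟩⟩
  · rw [ladderExtend_of_le l t (Nat.zero_le n), ladderExtend_of_le l t (Nat.zero_le n)]
    exact h.ext
  · intro i hi s
    rcases hi.lt_or_eq with hi | rfl
    · rw [ladderExtend_of_le l t (by omega)]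
      exact h.not_adj i (by omega) s
    · rw [ladderExtend_succ]
      cases s
      exacts [h3, h2]
  · rw [hset]
    exact hf
  · intro i hi s w hw
    rw [hset] at hw
    rcases hi.lt_or_eq with hi | rfl
    · rw [ladderExtend_of_le l t (by omega), h.out i (by omega) s w (fun e => hw (Or.inl e))]
      refine iff_of_false ?_ (by omega)
      rintro ⟨-, rfl⟩
      cases s <;> simp at hw
    · rw [ladderExtend_succ]
      cases s
      · exact (hy w hw).trans (by simp)
      · exact (hx w hw).trans (by simp)

/-- The edge from `t false` to `z` is the tail `cd` that closes a block `M n`. Its white vertices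
are `l n true`, `t false` and `z`, and their outside neighbors form the next front. -/
theorem exists_next_prefix [Finite V] (h : LadderStage G S B n l t z) (hG : IsCubic G)
    (hS : Progresses G S) (h1 : ¬ G.Adj (t true) (t false)) (h2 : ¬ G.Adj (t true) z)
    (h3 : G.Adj (t false) z) :
    ∃ B' x y z, B ⊂ B' ∧ Front G S B' x y z ∧ Extends G B' {x, y, z} := by
  obtain ⟨c', z', hf, hc', hz'⟩ := h.front.rotate.advance hG hS h3 (fun e => h1 e.symm)
    (fun e => h2 e.symm)
  obtain ⟨ψ, hr, hp, hw⟩ := h.ladder.exists_embedding_M (c := t false) (d := z)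
    (fun e => h.front.ny (Or.inr e)) (fun e => h.front.nz (Or.inr e)) h3
    (fun i hi s => h.adj_rung i hi s false) h.not_adj
  have hset : B ∪ Set.range ψ = B ∪ ladderSet n l ∪ {t false, z} := by
    rw [hr, Set.union_assoc]
  obtain ⟨H, hH, φ, hφr, hφw⟩ := h.ext.exists_isMChain ψ (by
    rw [hr, Set.disjoint_union_right]
    refine ⟨h.disj, Set.disjoint_left.2 ?_⟩
    rintro b hb (rfl | rfl)
    exacts [h.front.ny (Or.inl hb), h.front.nz (Or.inl hb)]) hp
  rw [hset] at hφr
  rw [hw] at hφw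
  have hln : l n true ∈ ladderSet n l := ⟨n, le_rfl, true, rfl⟩
  have hlc : t false ≠ l n true := fun e => h.front.ny (Or.inr (e ▸ hln))
  have hlz : z ≠ l n true := fun e => h.front.nz (Or.inr (e ▸ hln))
  classical
  -- On the three white vertices, `g` gives the unique neighbor outside the new prefix.
  let g : V → V := fun u => if u = l n true then t true else if u = t false then c' else z'
  have gl : g (l n true) = t true := if_pos rfl
  have gc : g (t false) = c' := by simp only [g, if_neg hlc, if_true]
  have gz : g z = z' := by simp only [g, if_neg hlz, if_neg h.front.yz.symm]
  have hext := extends_of_isMChain hH φ (g := g) ?_ ?_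
  · rw [hφw, hφr, Set.image_insert_eq, Set.image_pair, gl, gc, gz] at hext
    refine ⟨_, _, _, _, ?_, hf.rotate.rotate, hext⟩
    refine ⟨fun b hb => Or.inl (Or.inl hb), fun hsub => ?_⟩
    rcases hsub (Or.inr (Or.inr rfl)) with e
    exact h.front.nz (Or.inl e)
  · rw [hφw]
    have e1 := hf.xy
    have e2 := hf.xz
    have e3 := hf.yz
    rintro a (rfl | rfl | rfl) b (rfl | rfl | rfl) hab <;>
      first
      | rfl
      | (simp only [gl, gc, gz] at hab
         first
         | exact absurd hab ‹_›
         | exact absurd hab.symm ‹_›)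
  · rw [hφr, hφw]
    intro u hu w hw
    rcases hu with (hu | ⟨i, hi, s, rfl⟩) | rfl | rfl
    · refine iff_of_false (fun hadj => ?_) ?_
      · rcases h.front.out u (Or.inl hu) w (fun e => hw (Or.inl e)) hadj with rfl | rfl | rfl
        · exact h.not_adj_prefix hu _ hadj
        · exact h.not_adj_prefix hu _ hadj
        · exact hw (by simp)
      · rintro ⟨rfl | rfl | rfl, -⟩
        exacts [Set.disjoint_left.1 h.disj hu hln, h.front.ny (Or.inl hu), h.front.nz (Or.inl hu)]
    · rw [h.out i hi s w (fun e => hw (Or.inl e))]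
      constructor
      · rintro ⟨rfl, rfl⟩
        cases s
        · exact absurd (by simp) hw
        · exact ⟨by simp, gl.symm⟩
      · rintro ⟨e | e | e, rfl⟩
        · obtain ⟨rfl, rfl⟩ := h.ladder.inj i hi n le_rfl _ _ e
          exact ⟨rfl, gl⟩
        · exact absurd (Or.inr ⟨i, hi, s, e.symm⟩) h.front.ny
        · exact absurd (Or.inr ⟨i, hi, s, Eq.symm e⟩) h.front.nz
    · rw [hc' w hw, gc]
      simp
    · rw [hz' w hw, gz]
      simp

/-- Every extension adds a square, so `k` bounds the number of extensions left; at `k = 0` the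
ladder would have `2 * (n + 1) > card V` vertices. -/
theorem inFamily_or_exists_next_prefix [Fintype V] (hG : IsCubic G) (hS : Progresses G S)
    (k : ℕ) : ∀ n l t, LadderStage G S B n l t z → Fintype.card V ≤ n + k → InFamily G ∨
      ∃ B' x y z, B ⊂ B' ∧ Front G S B' x y z ∧ Extends G B' {x, y, z} := by
  induction k with
  | zero =>
    intro n l t h hk
    have := Fintype.card_le_of_injective _ h.ladder.injective
    simp only [Fintype.card_prod, Fintype.card_fin, Fintype.card_bool] at this
    omega
  | succ k ih =>
    intro n l t h hk
    rcases h.front.adj_cases hG hS with ⟨h1, h2, h3, hu⟩ | ⟨h1, h2, h3⟩ | ⟨h1, h2, h3⟩ |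
      ⟨h1, h2, h3⟩
    · exact Or.inl (h.inFamily h1 h2 h3 hu)
    · obtain ⟨t', h'⟩ := h.extend hG hS h1 h2 h3
      exact ih _ _ _ h' (by omega)
    -- The tail hangs on the top side here, so the two sides of the ladder are exchanged.
    · exact Or.inr (h.not.exists_next_prefix hG hS (fun e => h1 e.symm) h3 h2)
    · exact Or.inr (h.exists_next_prefix hG hS h1 h2 h3)

end LadderStage

theorem Front.exists_ladderStage [Finite V] {x y z : V} (h : Front G S B x y z)
    (hE : Extends G B {x, y, z}) (hG : IsCubic G) (hS : Progresses G S)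
    (hxy : G.Adj x y) (hxz : ¬ G.Adj x z) (hyz : ¬ G.Adj y z) :
    ∃ l t z, LadderStage G S B 0 l t z := by
  obtain ⟨x', y', hf, hx, hy⟩ := h.advance hG hS hxy hxz hyz
  have hset := ladderSet_zero x y
  refine ⟨fun _ s => cond s x y, fun s => cond s x' y', z,
    ⟨hE, ?_, isLadder_zero hxy, ?_, by rw [hset]; exact hf, ?_⟩⟩
  · rw [hset, Set.disjoint_right]
    rintro b (rfl | rfl)
    exacts [h.nx, h.ny]
  · rintro i - (_ | _)
    exacts [hyz, hxz]
  · intro i hi s w hw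
    rw [hset] at hw
    have h0 : i = 0 := by omega
    cases s
    · exact (hy w hw).trans (by simp [h0])
    · exact (hx w hw).trans (by simp [h0])

theorem Front.inFamily_of_triangle {x y z : V} (h : Front G S B x y z)
    (hE : Extends G B {x, y, z}) (hxy : G.Adj x y) (hxz : G.Adj x z) (hyz : G.Adj y z)
    (huniv : B ∪ {x, y, z} = Set.univ) : InFamily G := by
  have hset := ladderSet_zero x y
  obtain ⟨ψ, hr, hp⟩ := (isLadder_zero hxy).exists_embedding_T (z := z)
    (by rw [hset]; simp [h.xz.symm, h.yz.symm])
    (by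
      intro i hi s
      have h0 : i = 0 := by omega
      cases s
      exacts [iff_of_true hyz h0, iff_of_true hxz h0])
  rw [hset, Set.insert_union, Set.singleton_union] at hr
  refine hE.inFamily ψ ?_ hp (by rw [hr, huniv])
  rw [hr, Set.disjoint_right]
  rintro b (rfl | rfl | rfl)
  exacts [h.nx, h.ny, h.nz]

/-- Each closed block `M n` enlarges `B`, so the process must end in a block `T m`. The front is
rotated to make its single edge the first rung. -/
theorem Front.inFamily [Fintype V] (hG : IsCubic G) (hS : Progresses G S) (B : Set V) :
    ∀ x y z, Front G S B x y z → Extends G B {x, y, z} → InFamily G := by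
  induction B using set_induction_compl with
  | _ B ih =>
  intro x y z h hE
  have main : (∃ l t z, LadderStage G S B 0 l t z) → InFamily G := by
    rintro ⟨l, t, z, h⟩
    rcases LadderStage.inFamily_or_exists_next_prefix hG hS (Fintype.card V) 0 l t h (by omega)
      with h | ⟨B', x, y, z, hB', hf, hE'⟩
    · exact h
    · exact ih B' hB' x y z hf hE'
  have e1 : ({x, y, z} : Set V) = {y, z, x} := by
    rw [Set.insert_comm x y, Set.pair_comm x z]
  have e2 : ({x, y, z} : Set V) = {z, x, y} := by
    rw [Set.pair_comm y z, Set.insert_comm x z]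
  rcases h.adj_cases hG hS with ⟨h1, h2, h3, hu⟩ | ⟨h1, h2, h3⟩ | ⟨h1, h2, h3⟩ | ⟨h1, h2, h3⟩
  · exact h.inFamily_of_triangle hE h1 h2 h3 hu
  · exact main (h.exists_ladderStage hE hG hS h1 h2 h3)
  · exact main (h.rotate.rotate.exists_ladderStage (e2 ▸ hE) hG hS h2.symm (fun e => h3 e.symm) h1)
  · exact main (h.rotate.exists_ladderStage (e1 ▸ hE) hG hS h3 (fun e => h1 e.symm)
      (fun e => h2 e.symm))

theorem Progresses.inFamily [Fintype V] [Nonempty V] (hG : IsCubic G) {S : Finset V}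
    (hS : Progresses G (S : Set V)) (hc : S.card = 3) : InFamily G := by
  obtain ⟨u, y, z, v, hSe, hyz, hvu, hvy, hvz, hadj⟩ := hS.exists_first_force hG hc
  have hu : ∀ w, G.Adj u w → u ≠ w ∧ ∃ a ∈ ({u} : Set V), ∀ w' ∈ ({u} : Set V),
      G.Adj w w' ↔ w' = a := by
    intro w hw
    refine ⟨hw.ne, u, rfl, ?_⟩
    rintro _ rfl
    exact iff_of_true hw.symm rfl
  obtain ⟨nv, ov⟩ := hu v ((hadj v).2 (by simp))
  obtain ⟨ny, oy⟩ := hu y ((hadj y).2 (by simp))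
  obtain ⟨nz, oz⟩ := hu z ((hadj z).2 (by simp))
  -- The initial front consists of the three neighbors of the first forcing vertex, which is the
  -- apex of the cone.
  have hf : Front G (S : Set V) {u} v y z :=
    { sub := by
        rw [hSe]
        rintro w (rfl | rfl | rfl) <;> simp
      nx := nv.symm
      ny := ny.symm
      nz := nz.symm
      xy := hvy
      xz := hvz
      yz := hyz
      out := by
        rintro _ rfl w - hw
        exact (hadj w).1 hw
      ox := ov
      oy := oy
      oz := oz }
  exact Front.inFamily hG hS {u} v y z hf (extends_singleton hadj)

theorem InFamily.nonempty (h : InFamily G) : Nonempty V := by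
  obtain ⟨a, -⟩ := h.exists_forcing_triple
  exact ⟨a⟩

theorem InFamily.zeroForcingNumber_eq [Fintype V] (hG : IsCubic G) (h : InFamily G) :
    zeroForcingNumber G = 3 := by
  classical
  have := h.nonempty
  obtain ⟨a, b, c, hS⟩ := h.exists_forcing_triple
  refine le_antisymm ?_ (three_le_zeroForcingNumber hG)
  have hS' : Progresses G (({a, b, c} : Finset V) : Set V) := by simpa using hS
  exact (zeroForcingNumber_le hS').trans Finset.card_le_three

theorem maxNullity_eq_three [Fintype V] [Nonempty V] (hG : IsCubic G)
    (h : zeroForcingNumber G = 3) : maxNullity G = 3 := by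
  obtain ⟨S, hS, hc⟩ := exists_progresses_card_eq G
  exact le_antisymm (h ▸ maxNullity_le_zeroForcingNumber G)
    (three_le_maxNullity hG hS (hc.trans h))

end Structure

end CubicZF

theorem mainTheorem2 {V : Type*} [Fintype V] (G : SimpleGraph V) [G.LocallyFinite]
    (hG : G.IsRegularOfDegree 3) :
    (CubicZF.zeroForcingNumber G = 3 ∧ CubicZF.maxNullity G = 3) ↔ CubicZF.InFamily G := by
  have hG' := CubicZF.isCubic_of_isRegularOfDegree hG
  constructor
  · rintro ⟨h, -⟩
    obtain ⟨S, hS, hc⟩ := CubicZF.exists_progresses_card_eq G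
    rw [h] at hc
    obtain ⟨v, -⟩ : S.Nonempty := Finset.card_pos.1 (by omega)
    have : Nonempty V := ⟨v⟩
    exact hS.inFamily hG' hc
  · intro h
    have := h.nonempty
    have hZ := h.zeroForcingNumber_eq hG'
    exact ⟨hZ, CubicZF.maxNullity_eq_three hG' hZ⟩
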